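/- Let $k,\ell\ge 1$ be integers, and let $k$ servers be placed at points $s_1<\dots<s_k$ of the real line that are equally spaced, $s_{j+1}-s_j=d$ with a constant $d>0$; each server can be matched with at most $\ell$ requests (this is the problem $\mathrm{OFAL}_{eq}(k,\ell)$). Requests $r_1,\dots,r_n\in\mathbb R$, $n\le k\ell$, arrive one by one, and a deterministic online algorithm must irrevocably match each request, on arrival, with a free server, that is, one matched with fewer than $\ell$ requests so far; matching $r$ with $s$ costs $|r-s|$. Let $\mathrm{ALG}(\sigma)$ be the total cost of the algorithm on the request sequence $\sigma$, and $\mathrm{OPT}(\sigma)$ the least total cost of an assignment of the requests of $\sigma$ to the servers that respects the capacities. The algorithm is $c$-competitive if $\mathrm{ALG}(\sigma)\le c\cdot\mathrm{OPT}(\sigma)$ for every request sequence $\sigma$, and its competitive ratio is $\mathcal R(\mathrm{ALG})=\inf\{c\ge 1:\mathrm{ALG}\text{ is }c\text{-competitive}\}$ ($+\infty$ if there is no such $c$). The algorithm is an MPFS (most preferred free servers) algorithm if there is, for each $r\in\mathbb R$, a linear priority order of the servers that depends only on the position $r$, such that each request is matched with the free server of highest priority for it. Put $a=s_1$, $b=s_k$,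 and for $a\le x<y\le b$ let $B(x,y)=\frac{(b-x)y+(y-a)x}{(b-x)+(y-a)}$. For $\rho\in\mathbb R$ and $x,y\in[a,b]$ write $x\preceq_\rho y$ if $x=y$, or $x<y$ and $B(x,y)<\rho$, or $y<x$ and $\rho\le B(y,x)$. The algorithm $\mathrm{IDAS}_{[s_1,s_k]}$ matches each request $r$ with the free server that is the highest with respect to $\preceq_r$, that is, a free server $s$ such that $s'\preceq_r s$ for all free servers $s'$. Then $\mathrm{IDAS}_{[s_1,s_k]}$ exists, it is an MPFS algorithm, and $\mathcal R(\mathrm{IDAS}_{[s_1,s_k]})\le 2k-1$. Moreover, every MPFS algorithm $\mathrm{ALG}$ for the same servers and capacity satisfies $\mathcal R(\mathrm{ALG})\ge 2k-1$; hence $\mathcal R(\mathrm{IDAS}_{[s_1,s_k]})\le\mathcal R(\mathrm{ALG})$, so $\mathrm{IDAS}_{[s_1,s_k]}$ is best possible among MPFS algorithms. -/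

import Mathlib

noncomputable section

namespace OnlineFacility

/-- Number of requests of the sequence matched with server `s`, when requests are matched by the
decision rule `serve`. Request sequences are lists with the most recent request first, so that
`r :: h` is the sequence `h` followed by the new request `r`; `serve h r` is the server chosen
for `r` when the requests in `h` have been processed before. -/
def load {X : Type*} {k : ℕ} (serve : List X → X → Fin k) : List X → Fin k → ℕ
  | [], _ => 0
  | r :: h, s => load serve h s + if serve h r = s then 1 else 0

/-- A (deterministic) online algorithm for the facility assignment problem on `X` with `k` servers
of capacity `ℓ`. Each request is matched, irrevocably and knowing only the requests up to now,
with a server that is still free (as long as the sequence has at most `k * ℓ` requests). -/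
structure OnlineAlg (X : Type*) (k ℓ : ℕ) where
  serve : List X → X → Fin k
  feasible : ∀ (h : List X) (r : X), h.length < k * ℓ → load serve h (serve h r) < ℓ

/-- Server `s` is free after the requests in `h` have been processed. -/
def OnlineAlg.IsFree {X : Type*} {k ℓ : ℕ} (A : OnlineAlg X k ℓ) (h : List X) (s : Fin k) : Prop :=
  load A.serve h s < ℓ

/-- Total cost of the algorithm on a request sequence, for servers at the positions `p`. -/
def OnlineAlg.cost {X : Type*} [MetricSpace X] {k ℓ : ℕ} (p : Fin k → X) (A : OnlineAlg X k ℓ) :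
    List X → ℝ
  | [] => 0
  | r :: h => A.cost p h + dist r (p (A.serve h r))

/-- The offline optimum: the least cost of an assignment of all requests to servers that gives at
most `ℓ` requests to each server. (There are finitely many assignments, and at least one when the
sequence has at most `k * ℓ` requests.) -/
def opt {X : Type*} [MetricSpace X] {k : ℕ} (p : Fin k → X) (ℓ : ℕ) (σ : List X) : ℝ :=
  ⨅ f : {f : Fin σ.length → Fin k // ∀ s, (Finset.univ.filter fun i => f i = s).card ≤ ℓ},
    ∑ i, dist (σ.get i) (p (f.1 i))

/-- `c`-competitiveness, in the strict sense (no additive constant). -/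
def OnlineAlg.IsCompetitive {X : Type*} [MetricSpace X] {k ℓ : ℕ} (p : Fin k → X)
    (A : OnlineAlg X k ℓ) (c : ℝ) : Prop :=
  ∀ σ : List X, σ.length ≤ k * ℓ → A.cost p σ ≤ c * opt p ℓ σ

/-- The competitive ratio `inf {c ≥ 1 : A is c-competitive}`, which is `⊤` if there is no such
`c`. -/
def OnlineAlg.competitiveRatio {X : Type*} [MetricSpace X] {k ℓ : ℕ} (p : Fin k → X)
    (A : OnlineAlg X k ℓ) : EReal :=
  sInf ((fun c : ℝ => (c : EReal)) '' {c : ℝ | 1 ≤ c ∧ A.IsCompetitive p c})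

/-- Most preferred free server algorithms: the priority order of the servers for a request depends
only on the position of the request (greater means higher priority), and the request is matched
with the free server of highest priority. -/
def OnlineAlg.IsMPFS {X : Type*} {k ℓ : ℕ} (A : OnlineAlg X k ℓ) : Prop :=
  ∃ priority : X → LinearOrder (Fin k), ∀ (h : List X) (r : X), h.length < k * ℓ →
    ∀ s : Fin k, A.IsFree h s → (priority r).le s (A.serve h r)

/-- The point that internally divides `[x, y]` in the ratio `b - x` to `y - a`. -/
def divPoint (a b x y : ℝ) : ℝ :=
  ((b - x) * y + (y - a) * x) / ((b - x) + (y - a))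

/-- The relation `x ≼_ρ y` on `[a, b]`. -/
def idasLE (a b ρ x y : ℝ) : Prop :=
  x = y ∨ (x < y ∧ divPoint a b x y < ρ) ∨ (y < x ∧ ρ ≤ divPoint a b y x)

/-- `A` is the algorithm IDAS (Interior Division for Adjacent Servers) on `[a, b]`: each request `r`
is matched with the free server that is the highest with respect to `≼_r`. -/
def OnlineAlg.IsIDAS {k ℓ : ℕ} (a b : ℝ) (p : Fin k → ℝ) (A : OnlineAlg ℝ k ℓ) : Prop :=
  ∀ (h : List ℝ) (r : ℝ), h.length < k * ℓ →
    ∀ s : Fin k, A.IsFree h s → idasLE a b r (p s) (p (A.serve h r))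

/-- Servers at distance `d` from one another along the line, listed from left to right. -/
def Equispaced {k : ℕ} (p : Fin k → ℝ) (d : ℝ) : Prop :=
  0 < d ∧ ∀ (i j : Fin k), (j : ℕ) = (i : ℕ) + 1 → p j - p i = d

end OnlineFacility

end

/-! The upper bound rests on a potential. Put the servers at `0, …, n` with `n = k - 1` and capacity
one. Let `F` and `S` be the servers still to be used by the online run and by the offline solution,
and let `D g` be the net surplus of `F` over `S` to the left of `g`. The sum of the `|D (v + 1)|` is
the cost of transporting `F` to `S`. The potential is minus this sum, plus a weighted charge at each
free server. `abs_sub_add_potential_erase_le` shows that one request costs at most the drop of the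
potential plus `2 * n + 1 = 2 * k - 1` times its offline cost; the division points of IDAS are what
makes this balance on both sides. The potential vanishes when `F = S`, so the bounds telescope.

General capacity reduces to this case. `exists_full_extension` pads the requests until all capacity
is used, and `exists_transversal` (Hall's theorem) splits the requests into classes that use each
server once online and once offline. A server used by a later request of a class was free earlier,
so each class still obeys the IDAS preferences.

For the lower bound, an adversary leaves one free place at each server of a path ending in `a, y`. A
request at `r` takes the first server, a request at that server takes the next, and so on until `y`.
Online this costs at least `|r - a| + |a - y|`; offline, `r` goes to `y` and all other requests cost
nothing. `exists_anchored_partition` splits the servers into a part leading to the left end and a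
part leading to the right end, and some two neighbours lie in different parts. A suitable request
between these neighbours is expensive whichever of the two it prefers. -/

namespace OnlineFacility

/-! ### The potential and its change under one request. -/

/-- Number of elements of `F` below `g` minus number of elements of `S` below `g`. -/
def imbalance (F S : Finset ℕ) (g : ℕ) : ℤ :=
  ((F.filter (· < g)).card : ℤ) - ((S.filter (· < g)).card : ℤ)

/-- The contribution of vertex `v` to the potential. -/
def potentialTerm (n : ℕ) (F : Finset ℕ) (D : ℕ → ℤ) (v : ℕ) : ℤ :=
  (if v ∈ F then 2 * ((v : ℤ) * |D v| + ((n : ℤ) - v) * |D (v + 1)|) else 0) - |D (v + 1)|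

/-- The potential of the set `F` of free servers with imbalance function `D`. -/
def potential (n : ℕ) (F : Finset ℕ) (D : ℕ → ℤ) : ℤ :=
  ∑ v ∈ Finset.range (n + 1), potentialTerm n F D v

theorem imbalance_self (F : Finset ℕ) (g : ℕ) : imbalance F F g = 0 := by
  simp [imbalance]

theorem potential_of_forall_eq_zero {n : ℕ} {F : Finset ℕ} {D : ℕ → ℤ} (h : ∀ g, D g = 0) :
    potential n F D = 0 := by
  simp [potential, potentialTerm, h]

theorem card_filter_lt_succ (F : Finset ℕ) (v : ℕ) :
    (F.filter (· < v + 1)).card = (F.filter (· < v)).card + if v ∈ F then 1 else 0 := by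
  have h : F.filter (· < v + 1) = F.filter (· < v) ∪ F.filter (· = v) := by
    ext w; simp only [Finset.mem_filter, Finset.mem_union]; constructor
    · rintro ⟨h1, h2⟩
      rcases Nat.lt_succ_iff_lt_or_eq.mp h2 with h | h
      · exact Or.inl ⟨h1, h⟩
      · exact Or.inr ⟨h1, h⟩
    · rintro (⟨h1, h2⟩ | ⟨h1, h2⟩) <;> exact ⟨h1, by omega⟩
  rw [h, Finset.card_union_of_disjoint]
  · congr 1
    rw [Finset.filter_eq']
    split_ifs <;> simp
  · rw [Finset.disjoint_filter]; intro w _ h1 h2; omega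

/-- Hence the imbalance is monotone on stretches without free servers, and its value next to `x`
controls the whole stretch. -/
theorem imbalance_succ_le {F S : Finset ℕ} {v : ℕ} (hv : v ∉ F) :
    imbalance F S (v + 1) ≤ imbalance F S v := by
  unfold imbalance
  rw [card_filter_lt_succ, card_filter_lt_succ, if_neg hv]
  split_ifs <;> push_cast <;> linarith

theorem card_filter_erase_lt {F : Finset ℕ} {x : ℕ} (hx : x ∈ F) (g : ℕ) :
    (((F.erase x).filter (· < g)).card : ℤ) = (F.filter (· < g)).card - if x < g then 1 else 0 := by
  rw [Finset.filter_erase]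
  split_ifs with h
  · rw [Finset.card_erase_of_mem (by simp [hx, h])]
    have : 0 < (F.filter (· < g)).card := Finset.card_pos.mpr ⟨x, by simp [hx, h]⟩
    omega
  · rw [Finset.erase_eq_of_notMem (by simp [h])]; simp

theorem imbalance_erase {F S : Finset ℕ} {x s : ℕ} (hx : x ∈ F) (hs : s ∈ S) (g : ℕ) :
    imbalance (F.erase x) (S.erase s) g =
      imbalance F S g - (if x < g then 1 else 0) + if s < g then 1 else 0 := by
  unfold imbalance
  rw [card_filter_erase_lt hx, card_filter_erase_lt hs]
  ring

theorem le_of_forall_succ_le {D : ℕ → ℤ} {x t : ℕ} (hD : ∀ v, x ≤ v → v < t → D (v + 1) ≤ D v) :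
    ∀ v w, x ≤ v → v ≤ w → w ≤ t → D w ≤ D v := by
  intro v w hv hvw
  induction w, hvw using Nat.le_induction with
  | base => intro _; exact le_rfl
  | succ w hw ih => intro h; exact (hD w (by omega) (by omega)).trans (ih (by omega))

theorem abs_sub_one_cases (a : ℤ) : (|a - 1| = |a| + 1 ∧ a ≤ 0) ∨ (|a - 1| = |a| - 1 ∧ 1 ≤ a) := by
  rcases le_or_gt a 0 with h | h
  · left; rw [abs_of_nonpos h, abs_of_nonpos (by omega)]; omega
  · right; rw [abs_of_pos h, abs_of_nonneg (by omega)]; omega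

theorem abs_add_one_cases (a : ℤ) : (|a + 1| = |a| + 1 ∧ 0 ≤ a) ∨ (|a + 1| = |a| - 1 ∧ a ≤ -1) := by
  rcases le_or_gt 0 a with h | h
  · left; rw [abs_of_nonneg h, abs_of_nonneg (by omega)]; omega
  · right; rw [abs_of_neg h, abs_of_nonpos (by omega)]; omega

theorem sum_range_ite_Ico {n a b : ℕ} (hb : b ≤ n + 1) (hab : a ≤ b) (c : ℤ) :
    ∑ v ∈ Finset.range (n + 1), (if a ≤ v ∧ v < b then c else 0) = ((b : ℤ) - a) * c := by
  rw [← Finset.sum_filter]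
  have : (Finset.range (n + 1)).filter (fun v => a ≤ v ∧ v < b) = Finset.Ico a b := by
    ext v; simp; omega
  rw [this, Finset.sum_const, Nat.card_Ico, nsmul_eq_mul, Nat.cast_sub hab]

/-- Change of the potential when a request for `s` is matched with a server `x` to its left. -/
theorem potential_step_left {n : ℕ} {F : Finset ℕ} {D D' : ℕ → ℤ} {x s t : ℕ}
    (hD : ∀ v, v ∉ F → D (v + 1) ≤ D v)
    (hD' : ∀ g, D' g = D g - if x < g ∧ g ≤ s then 1 else 0)
    (hx : x ∈ F) (hs : s ≤ n) (hxt : x < t) (hts : t ≤ s) (hF : ∀ v, x < v → v < t → v ∉ F) :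
    potential n (F.erase x) D' + ((s : ℤ) - x) ≤
      potential n F D + 2 * n * ((s : ℤ) - t) + if s ∈ F then 2 * (s : ℤ) else 0 := by
  set M : ℤ := |D (x + 1)| with hM
  have hM0 : 0 ≤ M := abs_nonneg _
  -- The estimate is proved vertex by vertex. The charge of `x`, lost when `x` leaves `F`, pays `2 *
  -- M` at each vertex of `[x, t)`; a vertex of `[t, s)` may raise the potential by up to `2 * n`,
  -- less the 1 on the left; at `s` only the charge through `D s` can grow.
  have key : ∀ v ∈ Finset.range (n + 1),
      potentialTerm n (F.erase x) D' v + (if x ≤ v ∧ v < s then 1 else 0) ≤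
        potentialTerm n F D v + (if x ≤ v ∧ v < t then 2 * M else 0)
          + (if v = x then -(2 * ((n : ℤ) - x) * M) else 0)
          + (if t ≤ v ∧ v < s then 2 * (n : ℤ) else 0)
          + (if v = s then (if s ∈ F then 2 * (s : ℤ) else 0) else 0) := by
    intro v hv
    have hvn : v ≤ n := by simpa [Nat.lt_succ_iff] using hv
    have hvn' : (v : ℤ) ≤ n := by exact_mod_cast hvn
    have hsn' : (s : ℤ) ≤ n := by exact_mod_cast hs
    have hv0 : (0 : ℤ) ≤ v := by positivity
    unfold potentialTerm
    rcases lt_trichotomy v x with h | rfl | h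
    · have h1 : D' v = D v := by rw [hD', if_neg (by omega)]; simp
      have h2 : D' (v + 1) = D (v + 1) := by rw [hD', if_neg (by omega)]; simp
      rw [h1, h2, if_neg (show ¬ (x ≤ v ∧ v < s) by omega),
        if_neg (show ¬ (x ≤ v ∧ v < t) by omega), if_neg (show ¬ v = x by omega),
        if_neg (show ¬ (t ≤ v ∧ v < s) by omega), if_neg (show ¬ v = s by omega)]
      simp [Finset.mem_erase, show v ≠ x by omega]
    · have h2 : D' (v + 1) = D (v + 1) - 1 := by rw [hD', if_pos (by omega)]
      rw [h2, if_pos (show v ≤ v ∧ v < s by omega),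
        if_pos (show v ≤ v ∧ v < t by omega), if_pos rfl,
        if_neg (show ¬ (t ≤ v ∧ v < s) by omega), if_neg (show ¬ v = s by omega),
        if_neg (by simp), if_pos hx, ← hM]
      have h3 : 0 ≤ (v : ℤ) * |D v| := by positivity
      rcases abs_sub_one_cases (D (v + 1)) with ⟨e, h4⟩ | ⟨e, h4⟩
      · rw [e, ← hM]; nlinarith
      · have : 1 ≤ M := by rw [hM]; exact h4.trans (le_abs_self _)
        rw [e, ← hM]; nlinarith
    · rcases lt_trichotomy v s with h' | rfl | h'
      · have h1 : D' v = D v - 1 := by rw [hD', if_pos (by omega)]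
        have h2 : D' (v + 1) = D (v + 1) - 1 := by rw [hD', if_pos (by omega)]
        have hvs' : (v : ℤ) + 1 ≤ n := by exact_mod_cast (show v + 1 ≤ n by omega)
        rw [h1, h2, if_pos (show x ≤ v ∧ v < s by omega), if_neg (show ¬ v = x by omega),
          if_neg (show ¬ v = s by omega)]
        rcases lt_or_ge v t with h3 | h3
        · rw [if_pos (show x ≤ v ∧ v < t by omega), if_neg (show ¬ (t ≤ v ∧ v < s) by omega),
            if_neg (fun h4 => hF v h h3 (Finset.mem_of_mem_erase h4)), if_neg (hF v h h3)]
          have hmono : D (v + 1) ≤ D (x + 1) := by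
            refine le_of_forall_succ_le (x := x + 1) (t := t) (fun w hw hw' => hD w (hF w ?_ hw'))
              (x + 1) (v + 1) le_rfl ?_ ?_ <;> omega
          rcases abs_sub_one_cases (D (v + 1)) with ⟨e, h4⟩ | ⟨e, h4⟩
          · rw [e]; linarith
          · have : 1 ≤ M := by rw [hM]; exact (h4.trans hmono).trans (le_abs_self _)
            rw [e]; linarith
        · rw [if_neg (show ¬ (x ≤ v ∧ v < t) by omega), if_pos (show t ≤ v ∧ v < s by omega)]
          by_cases hvF : v ∈ F
          · rw [if_pos (Finset.mem_erase.mpr ⟨by omega, hvF⟩), if_pos hvF]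
            rcases abs_sub_one_cases (D (v + 1)) with ⟨e, h4⟩ | ⟨e, h4⟩ <;>
            rcases abs_sub_one_cases (D v) with ⟨e', h5⟩ | ⟨e', h5⟩ <;>
            rw [e, e'] <;> linarith
          · rw [if_neg (fun h4 => hvF (Finset.mem_of_mem_erase h4)), if_neg hvF]
            rcases abs_sub_one_cases (D (v + 1)) with ⟨e, h4⟩ | ⟨e, h4⟩ <;> rw [e] <;> linarith
      · have h1 : D' v = D v - 1 := by rw [hD', if_pos (by omega)]
        have h2 : D' (v + 1) = D (v + 1) := by rw [hD', if_neg (by omega)]; simp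
        rw [h1, h2, if_neg (show ¬ (x ≤ v ∧ v < v) by omega),
          if_neg (show ¬ (x ≤ v ∧ v < t) by omega), if_neg (show ¬ v = x by omega),
          if_neg (show ¬ (t ≤ v ∧ v < v) by omega), if_pos rfl]
        by_cases hvF : v ∈ F
        · rw [if_pos (Finset.mem_erase.mpr ⟨by omega, hvF⟩), if_pos hvF, if_pos hvF]
          rcases abs_sub_one_cases (D v) with ⟨e', h5⟩ | ⟨e', h5⟩ <;> rw [e'] <;> linarith
        · rw [if_neg (fun h4 => hvF (Finset.mem_of_mem_erase h4)), if_neg hvF, if_neg hvF]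
          linarith
      · have h1 : D' v = D v := by rw [hD', if_neg (by omega)]; simp
        have h2 : D' (v + 1) = D (v + 1) := by rw [hD', if_neg (by omega)]; simp
        rw [h1, h2, if_neg (show ¬ (x ≤ v ∧ v < s) by omega),
          if_neg (show ¬ (x ≤ v ∧ v < t) by omega), if_neg (show ¬ v = x by omega),
          if_neg (show ¬ (t ≤ v ∧ v < s) by omega), if_neg (show ¬ v = s by omega)]
        simp [Finset.mem_erase, show v ≠ x by omega]
  have hsum := Finset.sum_le_sum key
  simp only [Finset.sum_add_distrib] at hsum
  rw [sum_range_ite_Ico (by omega) (by omega), sum_range_ite_Ico (by omega) (by omega),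
    sum_range_ite_Ico (by omega) (by omega), Finset.sum_ite_eq', Finset.sum_ite_eq',
    if_pos (by simp; omega), if_pos (by simp; omega)] at hsum
  have htn : (t : ℤ) ≤ n := by exact_mod_cast (show t ≤ n by omega)
  -- Since `t ≤ n`, the lost charge covers all payments on `[x, t)`.
  have : ((t : ℤ) - x) * (2 * M) ≤ 2 * ((n : ℤ) - x) * M := by nlinarith
  unfold potential
  linarith

/-- Change of the potential when a request for `s` is matched with a server `x` to its right. -/
theorem potential_step_right {n : ℕ} {F : Finset ℕ} {D D' : ℕ → ℤ} {x s t : ℕ}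
    (hD : ∀ v, v ∉ F → D (v + 1) ≤ D v)
    (hD' : ∀ g, D' g = D g + if s < g ∧ g ≤ x then 1 else 0)
    (hx : x ∈ F) (hxn : x ≤ n) (htx : t < x) (hst : s ≤ t) (hF : ∀ v, t < v → v < x → v ∉ F) :
    potential n (F.erase x) D' + ((x : ℤ) - s) ≤
      potential n F D + 2 * n * ((t : ℤ) - s) +
        if s ∈ F ∨ s < t then 2 * ((n : ℤ) - s) else 0 := by
  set M : ℤ := |D x| with hM
  have hM0 : 0 ≤ M := abs_nonneg _
  -- This is not an exact mirror image, because the gap `v + 1` is attached to its left vertex `v`.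
  -- The affected gaps belong to the vertices `s, …, x - 1`, so `s` itself may need a payment even
  -- if it is not free.
  have key : ∀ v ∈ Finset.range (n + 1),
      potentialTerm n (F.erase x) D' v + (if s ≤ v ∧ v < x then 1 else 0) ≤
        potentialTerm n F D v + (if t ≤ v ∧ v < x then 2 * M else 0)
          + (if v = x then -(2 * (x : ℤ) * M) else 0)
          + (if s + 1 ≤ v ∧ v < t + 1 then 2 * (n : ℤ) else 0)
          + (if v = s then (if s ∈ F ∨ s < t then 2 * ((n : ℤ) - s) else 0) else 0) := by
    intro v hv
    have hvn : v ≤ n := by simpa [Nat.lt_succ_iff] using hv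
    have hvn' : (v : ℤ) ≤ n := by exact_mod_cast hvn
    have hv0 : (0 : ℤ) ≤ v := by positivity
    unfold potentialTerm
    rcases lt_trichotomy v x with h | rfl | h
    · have hvx' : (v : ℤ) + 1 ≤ n := by exact_mod_cast (show v + 1 ≤ n by omega)
      rw [if_neg (show ¬ v = x by omega)]
      have hmono : t ≤ v → D x ≤ D (v + 1) := by
        intro hv
        refine le_of_forall_succ_le (x := v + 1) (t := x) (fun w hw hw' => hD w (hF w ?_ hw'))
          (v + 1) x le_rfl ?_ ?_ <;> omega
      have hMge : t ≤ v → D (v + 1) ≤ -1 → 1 ≤ M := by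
        intro h1 h2
        have h3 := hmono h1
        rw [hM, abs_of_neg (by omega)]
        omega
      rcases lt_trichotomy v s with h' | rfl | h'
      · have h1 : D' v = D v := by rw [hD', if_neg (by omega)]; simp
        have h2 : D' (v + 1) = D (v + 1) := by rw [hD', if_neg (by omega)]; simp
        rw [h1, h2, if_neg (show ¬ (s ≤ v ∧ v < x) by omega),
          if_neg (show ¬ (t ≤ v ∧ v < x) by omega), if_neg (show ¬ v = s by omega),
          if_neg (show ¬ (s + 1 ≤ v ∧ v < t + 1) by omega)]
        simp [Finset.mem_erase, show v ≠ x by omega]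
      · have h1 : D' v = D v := by rw [hD', if_neg (by omega)]; simp
        have h2 : D' (v + 1) = D (v + 1) + 1 := by rw [hD', if_pos (by omega)]
        rw [h1, h2, if_pos (show v ≤ v ∧ v < x by omega), if_pos rfl,
          if_neg (show ¬ (v + 1 ≤ v ∧ v < t + 1) by omega)]
        have hind : 0 ≤ (if t ≤ v ∧ v < x then 2 * M else 0) := by split_ifs <;> linarith
        by_cases hvF : v ∈ F
        · rw [if_pos (Finset.mem_erase.mpr ⟨by omega, hvF⟩), if_pos hvF, if_pos (Or.inl hvF)]
          rcases abs_add_one_cases (D (v + 1)) with ⟨e, h4⟩ | ⟨e, h4⟩ <;> rw [e] <;> linarith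
        · rw [if_neg (fun h4 => hvF (Finset.mem_of_mem_erase h4)), if_neg hvF]
          rcases Nat.lt_or_ge v t with h3 | h3
          · rw [if_pos (Or.inr h3)]
            rcases abs_add_one_cases (D (v + 1)) with ⟨e, h4⟩ | ⟨e, h4⟩ <;> rw [e] <;> linarith
          · rw [if_neg (show ¬ (v ∈ F ∨ v < t) by rintro (h4 | h4); exacts [hvF h4, by omega]),
              if_pos ⟨h3, h⟩]
            rcases abs_add_one_cases (D (v + 1)) with ⟨e, h4⟩ | ⟨e, h4⟩
            · rw [e]; linarith
            · have := hMge h3 h4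
              rw [e]; linarith
      · have h1 : D' v = D v + 1 := by rw [hD', if_pos (by omega)]
        have h2 : D' (v + 1) = D (v + 1) + 1 := by rw [hD', if_pos (by omega)]
        rw [h1, h2, if_pos (show s ≤ v ∧ v < x by omega), if_neg (show ¬ v = s by omega)]
        rcases Nat.lt_or_ge t v with h3 | h3
        · rw [if_pos (show t ≤ v ∧ v < x by omega),
            if_neg (show ¬ (s + 1 ≤ v ∧ v < t + 1) by omega),
            if_neg (fun h4 => hF v h3 h (Finset.mem_of_mem_erase h4)), if_neg (hF v h3 h)]
          rcases abs_add_one_cases (D (v + 1)) with ⟨e, h4⟩ | ⟨e, h4⟩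
          · rw [e]; linarith
          · have := hMge h3.le h4
            rw [e]; linarith
        · have hind : 0 ≤ (if t ≤ v ∧ v < x then 2 * M else 0) := by split_ifs <;> linarith
          rw [if_pos (show s + 1 ≤ v ∧ v < t + 1 by omega)]
          by_cases hvF : v ∈ F
          · rw [if_pos (Finset.mem_erase.mpr ⟨by omega, hvF⟩), if_pos hvF]
            rcases abs_add_one_cases (D (v + 1)) with ⟨e, h4⟩ | ⟨e, h4⟩ <;>
            rcases abs_add_one_cases (D v) with ⟨e', h5⟩ | ⟨e', h5⟩ <;>
            rw [e, e'] <;> linarith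
          · rw [if_neg (fun h4 => hvF (Finset.mem_of_mem_erase h4)), if_neg hvF]
            rcases abs_add_one_cases (D (v + 1)) with ⟨e, h4⟩ | ⟨e, h4⟩ <;> rw [e] <;> linarith
    · have h2 : D' (v + 1) = D (v + 1) := by rw [hD', if_neg (by omega)]; simp
      rw [h2, if_neg (show ¬ (s ≤ v ∧ v < v) by omega),
        if_neg (show ¬ (t ≤ v ∧ v < v) by omega), if_pos rfl,
        if_neg (show ¬ (s + 1 ≤ v ∧ v < t + 1) by omega), if_neg (show ¬ v = s by omega),
        if_neg (by simp), if_pos hx, ← hM]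
      have h3 : 0 ≤ ((n : ℤ) - v) * |D (v + 1)| :=
        mul_nonneg (by linarith) (abs_nonneg _)
      linarith
    · have h1 : D' v = D v := by rw [hD', if_neg (by omega)]; simp
      have h2 : D' (v + 1) = D (v + 1) := by rw [hD', if_neg (by omega)]; simp
      rw [h1, h2, if_neg (show ¬ (s ≤ v ∧ v < x) by omega),
        if_neg (show ¬ (t ≤ v ∧ v < x) by omega), if_neg (show ¬ v = x by omega),
        if_neg (show ¬ (s + 1 ≤ v ∧ v < t + 1) by omega), if_neg (show ¬ v = s by omega)]
      simp [Finset.mem_erase, show v ≠ x by omega]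
  have hsum := Finset.sum_le_sum key
  simp only [Finset.sum_add_distrib] at hsum
  rw [sum_range_ite_Ico (by omega) (by omega), sum_range_ite_Ico (by omega) (by omega),
    sum_range_ite_Ico (by omega) (by omega), Finset.sum_ite_eq', Finset.sum_ite_eq',
    if_pos (by simp; omega), if_pos (by simp; omega)] at hsum
  have : ((x : ℤ) - t) * (2 * M) ≤ 2 * (x : ℤ) * M := by
    have : (0 : ℤ) ≤ t := by positivity
    nlinarith
  push_cast at hsum
  unfold potential
  linarith

/-- The potential pays for serving one request by the rule of interior division. The request is at
`r`, the servers are at the points `0, …, n`, `x` is the server chosen from the free servers `F`,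
and `s` is the server that serves the request in the offline solution. -/
theorem abs_sub_add_potential_erase_le {n : ℕ} {F S : Finset ℕ} {x s : ℕ} {r : ℝ}
    (hFn : ∀ v ∈ F, v ≤ n) (hSn : ∀ v ∈ S, v ≤ n) (hx : x ∈ F) (hs : s ∈ S)
    (hleft : ∀ z ∈ F, z < x → (n : ℝ) * x ≤ r * (n + x - z))
    (hright : ∀ z ∈ F, x < z → r * (n + z - x) ≤ (n : ℝ) * z) :
    |r - x| + potential n (F.erase x) (imbalance (F.erase x) (S.erase s)) ≤
      potential n F (imbalance F S) + (2 * (n : ℝ) + 1) * |r - s| := by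
  have hD : ∀ v, v ∉ F → imbalance F S (v + 1) ≤ imbalance F S v := fun v => imbalance_succ_le
  have hn0 : (0 : ℝ) ≤ n := by positivity
  have hxn := hFn x hx
  have hsn := hSn s hs
  have hxn' : (x : ℝ) ≤ n := by exact_mod_cast hxn
  have hsn' : (s : ℝ) ≤ n := by exact_mod_cast hsn
  have hx0' : (0 : ℝ) ≤ x := by positivity
  have hs0' : (0 : ℝ) ≤ s := by positivity
  rcases lt_trichotomy x s with h | rfl | h
  · have hxs : (x : ℝ) + 1 ≤ s := by exact_mod_cast h
    have hD' : ∀ g, imbalance (F.erase x) (S.erase s) g =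
        imbalance F S g - if x < g ∧ g ≤ s then 1 else 0 := by
      intro g
      rw [imbalance_erase hx hs]
      split_ifs <;> omega
    -- If some server of `F` lies in `(x, s]`, the nearest one to `x` was rejected in favour of `x`,
    -- which bounds `r` from above. Otherwise the potential drops by at least the detour `s - x`.
    by_cases hf : ∃ f, f ∈ F ∧ x < f ∧ f ≤ s
    · classical
      obtain ⟨hfF, hxf, hfs⟩ := Nat.find_spec hf
      have hmin : ∀ v, x < v → v < Nat.find hf → v ∉ F := fun v h1 h2 h3 =>
        Nat.find_min hf h2 ⟨h3, h1, by omega⟩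
      generalize Nat.find hf = f at *
      have hstep := potential_step_left hD hD' hx hsn hxf hfs hmin
      have hstep' : (potential n (F.erase x) (imbalance (F.erase x) (S.erase s)) : ℝ) + (s - x) ≤
          potential n F (imbalance F S) + 2 * n * ((s : ℝ) - f) + 2 * s := by
        have : (if s ∈ F then 2 * (s : ℤ) else 0) ≤ 2 * (s : ℤ) := by
          split_ifs
          · exact le_rfl
          · positivity
        have h3 := (Int.cast_le (R := ℝ)).mpr (hstep.trans (add_le_add_right this _))
        push_cast at h3
        linarith
      have hr := hright f hfF hxf
      have hxf' : (x : ℝ) + 1 ≤ f := by exact_mod_cast hxf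
      have hfs' : (f : ℝ) ≤ s := by exact_mod_cast hfs
      have hpos : (0 : ℝ) < n + f - x := by linarith
      have hrs : r ≤ s := by
        by_contra hcon
        push Not at hcon
        nlinarith
      rw [abs_sub_comm r s, abs_of_nonneg (sub_nonneg.mpr hrs)]
      rcases le_total (x : ℝ) r with hxr | hxr
      · rw [abs_of_nonneg (sub_nonneg.mpr hxr)]
        -- Up to the positive factor this is `(n + 1) * (f - r) ≥ f`, exactly what is left to prove
        -- once the bound `hstep'` is inserted.
        have h1 : (n + f - x) * ((n + 1) * (f - r)) ≥ (n + f - x) * (f : ℝ) := by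
          have : (n + f - x) * (f - r) ≥ (f : ℝ) * (f - x) := by nlinarith
          have h2 : (f : ℝ) * ((n + 1) * (f - x)) ≥ f * (n + f - x) := by
            apply mul_le_mul_of_nonneg_left _ (by linarith)
            nlinarith
          nlinarith
        have h2 := le_of_mul_le_mul_left h1 hpos
        nlinarith
      · rw [abs_sub_comm, abs_of_nonneg (sub_nonneg.mpr hxr)]
        nlinarith
    · push Not at hf
      have hsF : s ∉ F := fun h1 => absurd (hf s h1 h) (by omega)
      have hstep := potential_step_left hD hD' hx hsn h le_rfl
        (fun v h1 h2 h3 => absurd (hf v h3 h1) (by omega))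
      rw [if_neg hsF] at hstep
      have hstep' : (potential n (F.erase x) (imbalance (F.erase x) (S.erase s)) : ℝ) + (s - x) ≤
          potential n F (imbalance F S) := by
        exact_mod_cast hstep.trans (by linarith)
      have h1 : |r - x| ≤ |r - s| + (s - x) := by
        have := abs_sub_le r s x
        rwa [abs_of_nonneg (show (0 : ℝ) ≤ (s : ℝ) - x by linarith)] at this
      have h2 : 0 ≤ 2 * (n : ℝ) * |r - s| := by positivity
      linarith
  · have hle : potential n (F.erase x) (imbalance (F.erase x) (S.erase x)) ≤
        potential n F (imbalance F S) := by
      -- Both sets lose the same server, so only the nonnegative charge at `x` disappears.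
      have hD' : imbalance (F.erase x) (S.erase x) = imbalance F S := by
        funext g
        rw [imbalance_erase hx hs]; ring
      rw [hD']
      refine Finset.sum_le_sum fun v hv => ?_
      have hvn : (v : ℤ) ≤ n := by
        exact_mod_cast (show v ≤ n by simpa [Nat.lt_succ_iff] using hv)
      unfold potentialTerm
      have : 0 ≤ 2 * ((v : ℤ) * |imbalance F S v| + (n - v) * |imbalance F S (v + 1)|) := by
        have := mul_nonneg (sub_nonneg.mpr hvn) (abs_nonneg (imbalance F S (v + 1)))
        positivity
      by_cases h1 : v ∈ F.erase x
      · rw [if_pos h1, if_pos (Finset.mem_of_mem_erase h1)]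
      · rw [if_neg h1]
        split_ifs <;> linarith
    have hle' : (potential n (F.erase x) (imbalance (F.erase x) (S.erase x)) : ℝ) ≤
        potential n F (imbalance F S) := by exact_mod_cast hle
    have h2 : 0 ≤ 2 * (n : ℝ) * |r - x| := by positivity
    linarith
  · have hxs : (s : ℝ) + 1 ≤ x := by exact_mod_cast h
    have hD' : ∀ g, imbalance (F.erase x) (S.erase s) g =
        imbalance F S g + if s < g ∧ g ≤ x then 1 else 0 := by
      intro g
      rw [imbalance_erase hx hs]
      split_ifs <;> omega
    -- Minimising the distance `m` to `x` yields the largest server of `F` in `[s, x)`.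
    by_cases hf : ∃ m, m ≤ x ∧ x - m ∈ F ∧ x - m < x ∧ s ≤ x - m
    · classical
      obtain ⟨hmx, hfF, hxf, hfs⟩ := Nat.find_spec hf
      have hmin : ∀ v, x - Nat.find hf < v → v < x → v ∉ F := fun v h1 h2 h3 =>
        Nat.find_min hf (m := x - v) (by omega)
          ⟨by omega, by rwa [Nat.sub_sub_self h2.le], by omega, by omega⟩
      generalize x - Nat.find hf = f at *
      have hstep := potential_step_right hD hD' hx hxn hxf hfs hmin
      have hstep' : (potential n (F.erase x) (imbalance (F.erase x) (S.erase s)) : ℝ) + (x - s) ≤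
          potential n F (imbalance F S) + 2 * n * ((f : ℝ) - s) + 2 * (n - s) := by
        have : (if s ∈ F ∨ s < f then 2 * ((n : ℤ) - s) else 0) ≤ 2 * ((n : ℤ) - s) := by
          have : (s : ℤ) ≤ n := by exact_mod_cast hsn
          split_ifs <;> linarith
        have h3 := (Int.cast_le (R := ℝ)).mpr (hstep.trans (add_le_add_right this _))
        push_cast at h3
        linarith
      have hr := hleft f hfF hxf
      have hxf' : (f : ℝ) + 1 ≤ x := by exact_mod_cast hxf
      have hfs' : (s : ℝ) ≤ f := by exact_mod_cast hfs
      have hpos : (0 : ℝ) < n + x - f := by linarith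
      have hrs : s ≤ r := by
        by_contra hcon
        push Not at hcon
        nlinarith
      rw [abs_of_nonneg (sub_nonneg.mpr hrs)]
      rcases le_total r (x : ℝ) with hxr | hxr
      · rw [abs_sub_comm, abs_of_nonneg (sub_nonneg.mpr hxr)]
        have h1 : (n + x - f) * ((n + 1) * (r - f)) ≥ (n + x - f) * ((n : ℝ) - f) := by
          have : (n + x - f) * (r - f) ≥ ((n : ℝ) - f) * (x - f) := by nlinarith
          have h2 : ((n : ℝ) - f) * ((n + 1) * (x - f)) ≥ (n - f) * (n + x - f) := by
            apply mul_le_mul_of_nonneg_left _ (by linarith)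
            nlinarith
          nlinarith
        have h2 := le_of_mul_le_mul_left h1 hpos
        nlinarith
      · rw [abs_of_nonneg (sub_nonneg.mpr hxr)]
        nlinarith
    · push Not at hf
      have hf' : ∀ v, s ≤ v → v < x → v ∉ F := fun v h1 h2 h3 =>
        absurd (hf (x - v) (by omega) (by rwa [Nat.sub_sub_self h2.le]) (by omega)) (by omega)
      have hsF : ¬ (s ∈ F ∨ s < s) := by
        rintro (h1 | h1)
        exacts [hf' s le_rfl h h1, lt_irrefl _ h1]
      have hstep := potential_step_right hD hD' hx hxn h le_rfl
        (fun v h1 h2 h3 => hf' v h1.le h2 h3)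
      rw [if_neg hsF] at hstep
      have hstep' : (potential n (F.erase x) (imbalance (F.erase x) (S.erase s)) : ℝ) + (x - s) ≤
          potential n F (imbalance F S) := by
        exact_mod_cast hstep.trans (by linarith)
      have h1 : |r - x| ≤ |r - s| + (x - s) := by
        have := abs_sub_le r s x
        rwa [abs_sub_comm (s : ℝ) x,
          abs_of_nonneg (show (0 : ℝ) ≤ (x : ℝ) - s by linarith)] at this
      have h2 : 0 ≤ 2 * (n : ℝ) * |r - s| := by positivity
      linarith

/-! ### Runs with unit capacity. -/

/-- Total cost of a run with servers of capacity one at the points `0, …, n`. Request `i` is at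
`r i`, it is matched with the server `x i`, and with `s i` in the offline solution. -/
theorem sum_abs_sub_le_potential {ι : Type*} [LinearOrder ι] {n : ℕ} (T : Finset ι)
    (r : ι → ℝ) (x s : ι → ℕ) (hxn : ∀ i ∈ T, x i ≤ n) (hsn : ∀ i ∈ T, s i ≤ n)
    (hx : Set.InjOn x T) (hs : Set.InjOn s T)
    (hleft : ∀ i ∈ T, ∀ j ∈ T, i ≤ j → x j < x i → (n : ℝ) * x i ≤ r i * (n + x i - x j))
    (hright : ∀ i ∈ T, ∀ j ∈ T, i ≤ j → x i < x j → r i * (n + x j - x i) ≤ (n : ℝ) * x j) :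
    ∑ i ∈ T, |r i - x i| ≤ potential n (T.image x) (imbalance (T.image x) (T.image s)) +
      (2 * (n : ℝ) + 1) * ∑ i ∈ T, |r i - s i| := by
  -- The earliest request `a` is split off; after it, `F` and `S` are the images of the later
  -- requests.
  induction T using Finset.induction_on_min with
  | empty =>
    simp [potential_of_forall_eq_zero (imbalance_self _)]
  | insert a T ha ih =>
    have haT : a ∉ T := fun h => lt_irrefl _ (ha a h)
    have hle : ∀ j ∈ insert a T, a ≤ j := fun j hj => by
      rcases Finset.mem_insert.mp hj with rfl | h
      exacts [le_rfl, (ha j h).le]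
    have ih' := ih (fun i hi => hxn i (Finset.mem_insert_of_mem hi))
      (fun i hi => hsn i (Finset.mem_insert_of_mem hi))
      (hx.mono (by simp)) (hs.mono (by simp))
      (fun i hi j hj => hleft i (Finset.mem_insert_of_mem hi) j (Finset.mem_insert_of_mem hj))
      (fun i hi j hj => hright i (Finset.mem_insert_of_mem hi) j (Finset.mem_insert_of_mem hj))
    have herase : ∀ y : ι → ℕ, Set.InjOn y (insert a T : Finset ι) →
        ((insert a T).image y).erase (y a) = T.image y := by
      intro y hy
      rw [Finset.image_insert, Finset.erase_insert]
      intro hmem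
      obtain ⟨j, hj, hja⟩ := Finset.mem_image.mp hmem
      have := hy (by simp [hj]) (by simp) hja
      exact haT (this ▸ hj)
    have hstep := abs_sub_add_potential_erase_le (n := n) (F := (insert a T).image x)
      (S := (insert a T).image s) (x := x a) (s := s a) (r := r a)
      (by simpa using hxn) (by simpa using hsn)
      (Finset.mem_image_of_mem _ (Finset.mem_insert_self _ _))
      (Finset.mem_image_of_mem _ (Finset.mem_insert_self _ _))
      (by
        intro z hz
        obtain ⟨j, hj, rfl⟩ := Finset.mem_image.mp hz
        exact hleft a (Finset.mem_insert_self _ _) j hj (hle j hj))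
      (by
        intro z hz
        obtain ⟨j, hj, rfl⟩ := Finset.mem_image.mp hz
        exact hright a (Finset.mem_insert_self _ _) j hj (hle j hj))
    rw [herase x hx, herase s hs] at hstep
    rw [Finset.sum_insert haT, Finset.sum_insert haT]
    linarith

theorem Equispaced.eq_add_mul {k : ℕ} {p : Fin k → ℝ} {d : ℝ} (hp : Equispaced p d) {s₁ : Fin k}
    (h_first : (s₁ : ℕ) = 0) (i : Fin k) : p i = p s₁ + d * (i : ℕ) := by
  obtain ⟨i, hi⟩ := i
  induction i with
  | zero =>
    have : s₁ = ⟨0, hi⟩ := Fin.ext h_first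
    simp [this]
  | succ m ih =>
    have h1 := hp.2 ⟨m, by omega⟩ ⟨m + 1, hi⟩ rfl
    have h2 := ih (by omega)
    push_cast
    simp only at h2
    linarith

theorem Equispaced.lt_iff {k : ℕ} {p : Fin k → ℝ} {d : ℝ} (hp : Equispaced p d) {i j : Fin k} :
    p i < p j ↔ (i : ℕ) < j := by
  have h0 : 0 < k := i.pos
  rw [hp.eq_add_mul (s₁ := ⟨0, h0⟩) rfl i, hp.eq_add_mul (s₁ := ⟨0, h0⟩) rfl j,
    add_lt_add_iff_left, mul_lt_mul_iff_right₀ hp.1, Nat.cast_lt]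

theorem Equispaced.injective {k : ℕ} {p : Fin k → ℝ} {d : ℝ} (hp : Equispaced p d) :
    Function.Injective p := by
  intro i j hij
  have h1 := hp.lt_iff (i := i) (j := j)
  have h2 := hp.lt_iff (i := j) (j := i)
  rw [hij] at h1 h2
  simp only [lt_irrefl, false_iff, not_lt] at h1 h2
  exact Fin.ext (le_antisymm h2 h1)

theorem divPoint_add_mul {a d n x y : ℝ} (hd : 0 < d) (h : 0 < n + y - x) :
    divPoint a (a + d * n) (a + d * x) (a + d * y) = a + d * (n * y / (n + y - x)) := by
  unfold divPoint
  have h1 : a + d * n - (a + d * x) + (a + d * y - a) = d * (n + y - x) := by ring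
  have h2 : d * (n + y - x) ≠ 0 := by positivity
  rw [h1, div_eq_iff h2]
  field_simp
  ring

/-- Cost of IDAS on a set `T` of requests whose online and offline servers are distinct. -/
theorem sum_dist_le_of_injOn {ι : Type*} [LinearOrder ι] {k : ℕ} {p : Fin k → ℝ} {d : ℝ}
    (hp : Equispaced p d) {s₁ sₖ : Fin k} (h_first : (s₁ : ℕ) = 0) (h_last : (sₖ : ℕ) = k - 1)
    (T : Finset ι) (r : ι → ℝ) (x s : ι → Fin k) (hx : Set.InjOn x T) (hs : Set.InjOn s T)
    (himage : T.image x = T.image s)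
    (hpref : ∀ i ∈ T, ∀ j ∈ T, i ≤ j → idasLE (p s₁) (p sₖ) (r i) (p (x j)) (p (x i))) :
    ∑ i ∈ T, dist (r i) (p (x i)) ≤ (2 * (k : ℝ) - 1) * ∑ i ∈ T, dist (r i) (p (s i)) := by
  classical
  have hd := hp.1
  obtain ⟨n, rfl⟩ : ∃ n, k = n + 1 := ⟨k - 1, by have := s₁.pos; omega⟩
  simp only [Nat.add_sub_cancel] at h_last
  have hpos := hp.eq_add_mul h_first
  have hlast : p sₖ = p s₁ + d * (n : ℝ) := by rw [hpos, h_last]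
  generalize p s₁ = a at *
  have hdist : ∀ (ρ : ℝ) (z : Fin (n + 1)), dist ρ (p z) = d * |(ρ - a) / d - (z : ℕ)| := by
    intro ρ z
    rw [Real.dist_eq, hpos, ← abs_of_pos hd, ← abs_mul, abs_of_pos hd]
    congr 1
    field_simp
    ring
  have hlt : ∀ z : Fin (n + 1), ((z : ℕ) : ℝ) ≤ n := fun z => by
    exact_mod_cast Nat.lt_succ_iff.mp z.isLt
  have hnn : ∀ z : Fin (n + 1), (0 : ℝ) ≤ ((z : ℕ) : ℝ) := fun z => by positivity
  have key := sum_abs_sub_le_potential (n := n) T (fun i => (r i - a) / d)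
    (fun i => (x i : ℕ)) (fun i => (s i : ℕ))
    (fun i _ => Nat.lt_succ_iff.mp (x i).isLt) (fun i _ => Nat.lt_succ_iff.mp (s i).isLt)
    (fun i hi j hj h => hx hi hj (Fin.ext h)) (fun i hi j hj h => hs hi hj (Fin.ext h))
    (by
      intro i hi j hj hij hlt'
      have hlt'' : ((x j : ℕ) : ℝ) < (x i : ℕ) := by exact_mod_cast hlt'
      have h0 : (0 : ℝ) < n + (x i : ℕ) - (x j : ℕ) := by linarith [hlt (x j), hnn (x i)]
      have hlt3 := hp.lt_iff.mpr hlt'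
      rcases hpref i hi j hj hij with h | ⟨-, h⟩ | ⟨h, -⟩
      · exact absurd h hlt3.ne
      · rw [hlast, hpos (x j), hpos (x i), divPoint_add_mul hd h0] at h
        have h1 : (n : ℝ) * (x i : ℕ) / (n + (x i : ℕ) - (x j : ℕ)) ≤ (r i - a) / d := by
          rw [le_div_iff₀ hd]; linarith
        rwa [div_le_iff₀ h0] at h1
      · exact absurd h hlt3.asymm)
    (by
      intro i hi j hj hij hlt'
      have hlt'' : ((x i : ℕ) : ℝ) < (x j : ℕ) := by exact_mod_cast hlt'
      have h0 : (0 : ℝ) < n + (x j : ℕ) - (x i : ℕ) := by linarith [hlt (x i), hnn (x j)]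
      have hlt3 := hp.lt_iff.mpr hlt'
      rcases hpref i hi j hj hij with h | ⟨h, -⟩ | ⟨-, h⟩
      · exact absurd h hlt3.ne'
      · exact absurd h hlt3.asymm
      · rw [hlast, hpos (x j), hpos (x i), divPoint_add_mul hd h0] at h
        have h1 : (r i - a) / d ≤ (n : ℝ) * (x j : ℕ) / (n + (x j : ℕ) - (x i : ℕ)) := by
          rw [div_le_iff₀ hd]; linarith
        rwa [le_div_iff₀ h0] at h1)
  -- Online and offline use the same servers overall, so the initial potential is zero.
  have himage' : T.image (fun i => (x i : ℕ)) = T.image (fun i => (s i : ℕ)) := by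
    have := congrArg (Finset.image (fun z : Fin (n + 1) => (z : ℕ))) himage
    simpa [Finset.image_image, Function.comp_def] using this
  rw [himage', potential_of_forall_eq_zero (imbalance_self _)] at key
  simp only [hdist, ← Finset.mul_sum]
  push_cast at key ⊢
  nlinarith

/-! ### Reduction of general capacity to unit capacity. -/

/-- Among requests such that every server is used `ℓ + 1` times online and offline, one can choose
requests such that every server is used once online and once offline. -/
theorem exists_transversal {ι : Type*} {k ℓ : ℕ} (I : Finset ι) (x s : ι → Fin k)
    (hx : ∀ z, (I.filter (fun i => x i = z)).card = ℓ + 1)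
    (hs : ∀ z, (I.filter (fun i => s i = z)).card = ℓ + 1) :
    ∃ T ⊆ I, Set.InjOn x T ∧ Set.InjOn s T ∧ T.image x = Finset.univ ∧
      T.image s = Finset.univ := by
  classical
  -- Requests are edges of a bipartite multigraph between online and offline servers, regular of
  -- degree `ℓ + 1`. Hall's condition follows by counting: the edges at `A` are among the edges at
  -- its neighbourhood `N`.
  have hall := (Finset.all_card_le_biUnion_card_iff_exists_injective
    (fun z : Fin k => (I.filter (fun i => x i = z)).image s)).mp (by
      intro A
      set N := A.biUnion (fun z : Fin k => (I.filter (fun i => x i = z)).image s) with hN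
      have h1 : (I.filter (fun i => x i ∈ A)).card = A.card * (ℓ + 1) := by
        rw [Finset.card_eq_sum_card_fiberwise (f := x) (t := A) (by intro i; simp),
          Finset.sum_const_nat]
        intro z hz
        rw [← hx z]
        congr 1
        ext i
        simp only [Finset.mem_filter]
        constructor
        · rintro ⟨⟨h1, h2⟩, h3⟩; exact ⟨h1, h3⟩
        · rintro ⟨h1, rfl⟩; exact ⟨⟨h1, hz⟩, rfl⟩
      have h2 : (I.filter (fun i => s i ∈ N)).card = N.card * (ℓ + 1) := by
        rw [Finset.card_eq_sum_card_fiberwise (f := s) (t := N) (by intro i; simp),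
          Finset.sum_const_nat]
        intro z hz
        rw [← hs z]
        congr 1
        ext i
        simp only [Finset.mem_filter]
        constructor
        · rintro ⟨⟨h1, h2⟩, h3⟩; exact ⟨h1, h3⟩
        · rintro ⟨h1, rfl⟩; exact ⟨⟨h1, hz⟩, rfl⟩
      have h3 : I.filter (fun i => x i ∈ A) ⊆ I.filter (fun i => s i ∈ N) := by
        intro i hi
        rw [Finset.mem_filter] at hi ⊢
        refine ⟨hi.1, Finset.mem_biUnion.mpr ⟨x i, hi.2, Finset.mem_image.mpr ⟨i, ?_, rfl⟩⟩⟩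
        simp [hi.1]
      have h4 := Finset.card_le_card h3
      rw [h1, h2] at h4
      exact Nat.le_of_mul_le_mul_right h4 (Nat.succ_pos ℓ))
  obtain ⟨f, hf, hmem⟩ := hall
  have hmem' : ∀ z, ∃ i ∈ I, x i = z ∧ s i = f z := by
    intro z
    obtain ⟨i, hi, his⟩ := Finset.mem_image.mp (hmem z)
    rw [Finset.mem_filter] at hi
    exact ⟨i, hi.1, hi.2, his⟩
  choose g hgI hgx hgs using hmem'
  have hfs : Function.Surjective f := Finite.surjective_of_injective hf
  refine ⟨Finset.univ.image g, ?_, ?_, ?_, ?_, ?_⟩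
  · intro i hi
    obtain ⟨z, -, rfl⟩ := Finset.mem_image.mp hi
    exact hgI z
  · intro i hi j hj hij
    obtain ⟨z, -, rfl⟩ := Finset.mem_image.mp (Finset.mem_coe.mp hi)
    obtain ⟨w, -, rfl⟩ := Finset.mem_image.mp (Finset.mem_coe.mp hj)
    rw [hgx, hgx] at hij
    rw [hij]
  · intro i hi j hj hij
    obtain ⟨z, -, rfl⟩ := Finset.mem_image.mp (Finset.mem_coe.mp hi)
    obtain ⟨w, -, rfl⟩ := Finset.mem_image.mp (Finset.mem_coe.mp hj)
    rw [hgs, hgs] at hij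
    rw [hf hij]
  · ext z
    simp only [Finset.mem_image, Finset.mem_univ, true_and, iff_true, exists_exists_eq_and]
    exact ⟨z, hgx z⟩
  · ext z
    simp only [Finset.mem_image, Finset.mem_univ, true_and, iff_true, exists_exists_eq_and]
    obtain ⟨w, rfl⟩ := hfs z
    exact ⟨w, hgs w⟩

theorem card_filter_sdiff_transversal {ι : Type*} [DecidableEq ι] {k ℓ : ℕ} {I T : Finset ι}
    {x : ι → Fin k} (hx : ∀ z, (I.filter (fun i => x i = z)).card = ℓ + 1) (hT : T ⊆ I)
    (hinj : Set.InjOn x T) (himage : T.image x = Finset.univ) (z : Fin k) :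
    ((I \ T).filter (fun i => x i = z)).card = ℓ := by
  have h1 : (T.filter (fun i => x i = z)).card = 1 := by
    obtain ⟨i, hi, hiz⟩ := Finset.mem_image.mp (himage.symm ▸ Finset.mem_univ z)
    rw [Finset.card_eq_one]
    refine ⟨i, ?_⟩
    ext j
    simp only [Finset.mem_filter, Finset.mem_singleton]
    constructor
    · rintro ⟨hj, hjz⟩; exact hinj hj hi (hjz.trans hiz.symm)
    · rintro rfl; exact ⟨hi, hiz⟩
  have h2 := hx z
  rw [← Finset.sdiff_union_of_subset hT, Finset.filter_union, Finset.card_union_of_disjoint, h1]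
    at h2
  · omega
  · exact Finset.disjoint_filter_filter Finset.sdiff_disjoint

/-- Cost of IDAS on a set of requests that uses every server `ℓ` times. -/
theorem sum_dist_le_of_card_eq {ι : Type*} [LinearOrder ι] {k : ℕ} {p : Fin k → ℝ} {d : ℝ}
    (hp : Equispaced p d) {s₁ sₖ : Fin k} (h_first : (s₁ : ℕ) = 0) (h_last : (sₖ : ℕ) = k - 1)
    (r : ι → ℝ) (x s : ι → Fin k) (ℓ : ℕ) (I : Finset ι)
    (hx : ∀ z, (I.filter (fun i => x i = z)).card = ℓ)
    (hs : ∀ z, (I.filter (fun i => s i = z)).card = ℓ)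
    (hpref : ∀ i ∈ I, ∀ j ∈ I, i ≤ j → idasLE (p s₁) (p sₖ) (r i) (p (x j)) (p (x i))) :
    ∑ i ∈ I, dist (r i) (p (x i)) ≤ (2 * (k : ℝ) - 1) * ∑ i ∈ I, dist (r i) (p (s i)) := by
  classical
  induction ℓ generalizing I with
  | zero =>
    have : I = ∅ := by
      rw [Finset.eq_empty_iff_forall_notMem]
      intro i hi
      have h1 := Finset.card_eq_zero.mp (hx (x i))
      exact Finset.notMem_empty i (h1 ▸ Finset.mem_filter.mpr ⟨hi, rfl⟩)
    simp [this]
  | succ m ih =>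
    obtain ⟨T, hTI, hTx, hTs, hix, his⟩ := exists_transversal I x s hx hs
    have h1 := sum_dist_le_of_injOn hp h_first h_last T r x s hTx hTs (hix.trans his.symm)
      (fun i hi j hj => hpref i (hTI hi) j (hTI hj))
    have h2 := ih (I \ T) (card_filter_sdiff_transversal hx hTI hTx hix)
      (card_filter_sdiff_transversal hs hTI hTs his)
      (fun i hi j hj => hpref i (Finset.sdiff_subset hi) j (Finset.sdiff_subset hj))
    rw [← Finset.sum_sdiff hTI, ← Finset.sum_sdiff hTI, mul_add]
    exact add_le_add h2 h1

/-! ### Loads, offline assignments and padding of request sequences. -/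

theorem sum_load {X : Type*} {k : ℕ} (serve : List X → X → Fin k) (σ : List X) :
    ∑ s, load serve σ s = σ.length := by
  induction σ with
  | nil => simp [load]
  | cons r h ih => simp [load, Finset.sum_add_distrib, ih]

theorem load_le_load_cons {X : Type*} {k : ℕ} (serve : List X → X → Fin k) (r : X) (h : List X)
    (s : Fin k) : load serve h s ≤ load serve (r :: h) s :=
  Nat.le_add_right _ _

theorem OnlineAlg.load_le {X : Type*} {k ℓ : ℕ} (A : OnlineAlg X k ℓ) (σ : List X)
    (hσ : σ.length ≤ k * ℓ) (s : Fin k) : load A.serve σ s ≤ ℓ := by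
  induction σ with
  | nil => simp [load]
  | cons r h ih =>
    have hlen : h.length < k * ℓ := by simpa using hσ
    unfold load
    split_ifs with hs
    · have := A.feasible h r hlen
      rw [hs] at this
      omega
    · simpa using ih hlen.le

/-- The servers chosen by an online algorithm, indexed as the requests of the sequence. -/
def choices {X : Type*} {k : ℕ} (serve : List X → X → Fin k) :
    (σ : List X) → Fin σ.length → Fin k
  | [] => Fin.elim0
  | r :: h => Fin.cons (serve h r) (choices serve h)

/-- The requests of `σ` can be assigned to servers at the positions `p` at total cost `C` such that
server `s` gets `m s` requests. -/
def IsOfflineCost {X : Type*} [MetricSpace X] {k : ℕ} (p : Fin k → X) (σ : List X)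
    (m : Fin k → ℕ) (C : ℝ) : Prop :=
  ∃ f : Fin σ.length → Fin k, (∀ s, (Finset.univ.filter fun i => f i = s).card = m s) ∧
    ∑ i, dist (σ.get i) (p (f i)) = C

theorem card_filter_cons {k N : ℕ} (t : Fin k) (f : Fin N → Fin k) (s : Fin k) :
    (Finset.univ.filter fun i => (Fin.cons t f : Fin (N + 1) → Fin k) i = s).card =
      (Finset.univ.filter fun i => f i = s).card + if t = s then 1 else 0 := by
  rw [Fin.card_filter_univ_succ]
  simp only [Fin.cons_zero, Fin.cons_succ]
  split_ifs <;> rfl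

theorem load_eq_card_filter {X : Type*} {k : ℕ} (serve : List X → X → Fin k) (σ : List X)
    (s : Fin k) : load serve σ s = (Finset.univ.filter fun i => choices serve σ i = s).card := by
  induction σ with
  | nil => simp [load]
  | cons r h ih => rw [load, ih]; exact (card_filter_cons _ _ _).symm

theorem OnlineAlg.cost_eq_sum {X : Type*} [MetricSpace X] {k ℓ : ℕ} (p : Fin k → X)
    (A : OnlineAlg X k ℓ) (σ : List X) :
    A.cost p σ = ∑ i, dist (σ.get i) (p (choices A.serve σ i)) := by
  induction σ with
  | nil => simp [OnlineAlg.cost]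
  | cons r h ih =>
    rw [OnlineAlg.cost, ih]
    refine Eq.trans ?_ (Fin.sum_univ_succ (n := h.length)
      (fun i => dist ((r :: h).get i) (p (choices A.serve (r :: h) i)))).symm
    rw [add_comm]
    rfl

theorem isOfflineCost_nil {X : Type*} [MetricSpace X] {k : ℕ} (p : Fin k → X) :
    IsOfflineCost p [] (fun _ => 0) 0 :=
  ⟨Fin.elim0, by simp, by simp⟩

theorem IsOfflineCost.cons {X : Type*} [MetricSpace X] {k : ℕ} {p : Fin k → X} {σ : List X}
    {m : Fin k → ℕ} {C : ℝ} (h : IsOfflineCost p σ m C) (r : X) (t : Fin k) :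
    IsOfflineCost p (r :: σ) (fun s => m s + if t = s then 1 else 0) (C + dist r (p t)) := by
  obtain ⟨f, hf, hC⟩ := h
  refine ⟨Fin.cons t f, fun s => ?_, ?_⟩
  · exact (card_filter_cons t f s).trans (by rw [hf s])
  · refine (Fin.sum_univ_succ (n := σ.length)
      (fun i => dist ((r :: σ).get i) (p ((Fin.cons t f : Fin (σ.length + 1) → Fin k) i)))).trans ?_
    rw [add_comm, ← hC]
    rfl

theorem IsOfflineCost.sum_eq {X : Type*} [MetricSpace X] {k : ℕ} {p : Fin k → X} {σ : List X}
    {m : Fin k → ℕ} {C : ℝ} (h : IsOfflineCost p σ m C) : ∑ s, m s = σ.length := by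
  obtain ⟨f, hf, -⟩ := h
  simp_rw [← hf]
  rw [← Finset.card_eq_sum_card_fiberwise (f := f) (s := Finset.univ) (t := Finset.univ) (by simp)]
  simp

theorem IsOfflineCost.opt_le {X : Type*} [MetricSpace X] {k ℓ : ℕ} {p : Fin k → X} {σ : List X}
    {m : Fin k → ℕ} {C : ℝ} (h : IsOfflineCost p σ m C) (hm : ∀ s, m s ≤ ℓ) :
    opt p ℓ σ ≤ C := by
  obtain ⟨f, hf, rfl⟩ := h
  exact ciInf_le (Set.finite_range _).bddBelow (⟨f, fun s => (hf s).trans_le (hm s)⟩ :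
    {f : Fin σ.length → Fin k // ∀ s, (Finset.univ.filter fun i => f i = s).card ≤ ℓ})

/-- An offline assignment that respects the capacities extends to one that uses them fully, without
additional cost. -/
theorem exists_full_extension {X : Type*} [MetricSpace X] {k ℓ : ℕ} (p : Fin k → X)
    (A : OnlineAlg X k ℓ) (σ : List X) (m : Fin k → ℕ) (C : ℝ) (h : IsOfflineCost p σ m C)
    (hm : ∀ s, m s ≤ ℓ) :
    ∃ τ : List X, A.cost p σ ≤ A.cost p τ ∧ IsOfflineCost p τ (fun _ => ℓ) C := by
  induction hN : k * ℓ - σ.length generalizing σ m with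
  | zero =>
    have hsum := h.sum_eq
    have hm' : ∀ s ∈ Finset.univ, m s = ℓ := by
      refine (Finset.sum_eq_sum_iff_of_le fun s _ => hm s).mp (le_antisymm
        (Finset.sum_le_sum fun s _ => hm s) ?_)
      rw [hsum]
      simp
      omega
    exact ⟨σ, le_rfl, by rwa [show m = fun _ => ℓ from funext fun s => hm' s (by simp)] at h⟩
  | succ N ih =>
    have hsum := h.sum_eq
    obtain ⟨t, ht⟩ : ∃ t, m t < ℓ := by
      by_contra hcon
      push Not at hcon
      have := Finset.sum_le_sum (s := Finset.univ) (fun s _ => hcon s)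
      rw [hsum] at this
      simp at this
      omega
    -- A request at a server with spare offline capacity is free offline and cannot lower the online
    -- cost.
    have h1 := h.cons (p t) t
    rw [dist_self, add_zero] at h1
    obtain ⟨τ, hτ, hoff⟩ := ih (p t :: σ) _ h1 (by
      intro s
      split_ifs with hs
      · subst hs; omega
      · simpa using hm s) (by simp; omega)
    refine ⟨τ, le_trans ?_ hτ, hoff⟩
    rw [OnlineAlg.cost]
    exact le_add_of_nonneg_right dist_nonneg

/-! ### Competitiveness of IDAS. -/

theorem idasLE_refl (a b ρ x : ℝ) : idasLE a b ρ x x := Or.inl rfl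

theorem OnlineAlg.IsIDAS.idasLE_choices_of_isFree {k ℓ : ℕ} {a b : ℝ} {p : Fin k → ℝ}
    {A : OnlineAlg ℝ k ℓ} (hA : A.IsIDAS a b p) (σ : List ℝ) (hσ : σ.length ≤ k * ℓ) (s : Fin k)
    (hs : A.IsFree σ s) (i : Fin σ.length) :
    idasLE a b (σ.get i) (p s) (p (choices A.serve σ i)) := by
  induction σ with
  | nil => exact i.elim0
  | cons r h ih =>
    have hlen : h.length < k * ℓ := by simpa using hσ
    have hs' : A.IsFree h s := (load_le_load_cons _ _ _ _).trans_lt hs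
    refine Fin.cases ?_ (fun j => ?_) i
    · exact hA h r hlen s hs'
    · exact ih hlen.le hs' j

/-- Index 0 is the most recent request, so `j ≤ i` means that `j` does not arrive before `i`; the
server later used by `j` was free when `i` was served. -/
theorem OnlineAlg.IsIDAS.idasLE_choices {k ℓ : ℕ} {a b : ℝ} {p : Fin k → ℝ}
    {A : OnlineAlg ℝ k ℓ} (hA : A.IsIDAS a b p) (σ : List ℝ) (hσ : σ.length ≤ k * ℓ)
    (i j : Fin σ.length) (hij : j ≤ i) :
    idasLE a b (σ.get i) (p (choices A.serve σ j)) (p (choices A.serve σ i)) := by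
  induction σ with
  | nil => exact i.elim0
  | cons r h ih =>
    have hlen : h.length < k * ℓ := by simpa using hσ
    revert hij
    refine Fin.cases ?_ (fun i' => ?_) i <;> refine Fin.cases ?_ (fun j' => ?_) j
    · intro _; exact idasLE_refl _ _ _ _
    · intro hij; exact absurd hij (by simp)
    · intro _
      exact hA.idasLE_choices_of_isFree h hlen.le _ (A.feasible h r hlen) i'
    · intro hij
      exact ih hlen.le i' j' (Fin.succ_le_succ_iff.mp hij)

theorem OnlineAlg.IsIDAS.isCompetitive {k ℓ : ℕ} {p : Fin k → ℝ} {d : ℝ} (hp : Equispaced p d)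
    {s₁ sₖ : Fin k} (h_first : (s₁ : ℕ) = 0) (h_last : (sₖ : ℕ) = k - 1) {A : OnlineAlg ℝ k ℓ}
    (hA : A.IsIDAS (p s₁) (p sₖ) p) : A.IsCompetitive p (2 * (k : ℝ) - 1) := by
  have hk : (1 : ℝ) ≤ k := by exact_mod_cast s₁.pos
  have main : ∀ (σ : List ℝ) (m : Fin k → ℕ) (C : ℝ), IsOfflineCost p σ m C → (∀ s, m s ≤ ℓ) →
      A.cost p σ ≤ (2 * (k : ℝ) - 1) * C := by
    intro σ m C h hm
    obtain ⟨τ, hτ, hoff⟩ := exists_full_extension p A σ m C h hm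
    refine hτ.trans ?_
    have hlen : τ.length = k * ℓ := by rw [← hoff.sum_eq]; simp
    have hload : ∀ z ∈ Finset.univ, load A.serve τ z = ℓ := by
      refine (Finset.sum_eq_sum_iff_of_le fun s _ => A.load_le τ hlen.le s).mp ?_
      rw [sum_load, hlen]
      simp
    obtain ⟨f, hf, rfl⟩ := hoff
    rw [OnlineAlg.cost_eq_sum]
    -- The order dual turns list positions into order of arrival.
    exact sum_dist_le_of_card_eq (ι := (Fin τ.length)ᵒᵈ) hp h_first h_last τ.get
      (choices A.serve τ) f ℓ Finset.univ
      (fun z => (load_eq_card_filter A.serve τ z).symm.trans (hload z (Finset.mem_univ z))) hf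
      (fun i _ j _ hij => hA.idasLE_choices τ hlen.le i j hij)
  intro σ hσ
  have : Nonempty {f : Fin σ.length → Fin k //
      ∀ s, (Finset.univ.filter fun i => f i = s).card ≤ ℓ} :=
    ⟨⟨choices A.serve σ, fun s => (load_eq_card_filter A.serve σ s).symm.trans_le
      (A.load_le σ hσ s)⟩⟩
  obtain ⟨f, hf⟩ := exists_eq_ciInf_of_finite (f := fun f : {f : Fin σ.length → Fin k //
      ∀ s, (Finset.univ.filter fun i => f i = s).card ≤ ℓ} => ∑ i, dist (σ.get i) (p (f.1 i)))
  unfold opt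
  rw [← hf]
  exact main σ _ _ ⟨f.1, fun s => rfl, rfl⟩ f.2

/-! ### The priority order of IDAS -/

/-- The key of the server at `z` in the priority order of IDAS for a request at `ρ`; servers with
smaller keys are preferred. -/
noncomputable def idasKey (a b ρ z : ℝ) : ℝ :=
  max ((z - a) * (b - max a (min b ρ)))
    ((max a (min b ρ) - a) * (b - z))

theorem lt_divPoint_bounds {a b x y : ℝ} (hax : a ≤ x) (hxy : x < y) (hyb : y ≤ b) :
    x < divPoint a b x y ∧ divPoint a b x y < y := by
  unfold divPoint
  have h : 0 < b - x + (y - a) := by linarith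
  rw [lt_div_iff₀ h, div_lt_iff₀ h]
  constructor <;> nlinarith

/-- The division point lies strictly between `x` and `y`, so `ρ` may be replaced by its projection
`c` to `[a, b]`. Clearing denominators then gives `(y - a) * (b - c) < (c - a) * (b - x)`: the
increasing branch of the key at `y` against the decreasing branch at `x`. -/
theorem divPoint_lt_iff {a b ρ x y : ℝ} (hax : a ≤ x) (hxy : x < y) (hyb : y ≤ b) :
    divPoint a b x y < ρ ↔ idasKey a b ρ y < idasKey a b ρ x := by
  have hB := lt_divPoint_bounds hax hxy hyb
  have h1 : divPoint a b x y < ρ ↔ divPoint a b x y < max a (min b ρ) := by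
    rw [lt_max_iff, lt_min_iff]
    constructor
    · intro h; exact Or.inr ⟨by linarith, h⟩
    · rintro (h | h)
      · linarith
      · exact h.2
  have ha : a ≤ max a (min b ρ) := le_max_left _ _
  have hb : max a (min b ρ) ≤ b := max_le (by linarith) (min_le_left _ _)
  rw [h1]
  unfold idasKey
  generalize max a (min b ρ) = c at *
  have h2 : divPoint a b x y < c ↔ (y - a) * (b - c) < (c - a) * (b - x) := by
    unfold divPoint
    have h : 0 < b - x + (y - a) := by linarith
    rw [div_lt_iff₀ h]
    constructor <;> intro h <;> nlinarith
  rw [h2, max_lt_iff, lt_max_iff, lt_max_iff]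
  constructor
  · intro h
    refine ⟨Or.inr (by nlinarith), Or.inr ?_⟩
    have : 0 < c - a := by
      rcases ha.eq_or_lt with h' | h'
      · subst h'; nlinarith
      · linarith
    nlinarith
  · rintro ⟨h | h, -⟩
    · nlinarith
    · linarith

/-- Comparison by a key makes transitivity and totality evident; the second coordinate resolves ties
in favour of the left server. -/
theorem idasLE_iff {a b ρ x y : ℝ} (hx : x ∈ Set.Icc a b) (hy : y ∈ Set.Icc a b) :
    idasLE a b ρ x y ↔ toLex (idasKey a b ρ y, y) ≤ toLex (idasKey a b ρ x, x) := by
  rw [Prod.Lex.toLex_le_toLex]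
  unfold idasLE
  rcases lt_trichotomy x y with h | rfl | h
  · rw [divPoint_lt_iff hx.1 h hy.2]
    constructor
    · rintro (h1 | ⟨-, h1⟩ | ⟨h1, -⟩)
      exacts [absurd h1 h.ne, Or.inl h1, absurd h1 h.asymm]
    · rintro (h1 | ⟨-, h1⟩)
      exacts [Or.inr (Or.inl ⟨h, h1⟩), absurd h (not_lt.mpr h1)]
  · simp
  · have h0 := divPoint_lt_iff (ρ := ρ) hy.1 h hx.2
    rw [← not_lt (b := ρ), h0, not_lt]
    constructor
    · rintro (h1 | ⟨h1, -⟩ | ⟨-, h1⟩)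
      · exact absurd h1 h.ne'
      · exact absurd h1 h.asymm
      · rcases h1.lt_or_eq with h2 | h2
        exacts [Or.inl h2, Or.inr ⟨h2, h.le⟩]
    · rintro (h1 | ⟨h1, -⟩)
      exacts [Or.inr (Or.inr ⟨h, h1.le⟩), Or.inr (Or.inr ⟨h, h1.le⟩)]

/-- The priority order of IDAS for a request at `ρ`. -/
@[reducible] noncomputable def idasOrder {k : ℕ} (p : Fin k → ℝ) (hp : Function.Injective p) (a b ρ : ℝ) :
    LinearOrder (Fin k) :=
  LinearOrder.lift' (fun i => OrderDual.toDual (toLex (idasKey a b ρ (p i), p i)))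
    (fun _ _ h => hp (congrArg Prod.snd (toLex.injective (OrderDual.toDual.injective h))))

theorem idasOrder_le_iff {k : ℕ} {p : Fin k → ℝ} (hp : Function.Injective p) {a b ρ : ℝ}
    (hab : ∀ i, p i ∈ Set.Icc a b) (i j : Fin k) :
    (idasOrder p hp a b ρ).le i j ↔ idasLE a b ρ (p i) (p j) :=
  (idasLE_iff (hab i) (hab j)).symm

theorem OnlineAlg.IsIDAS.isMPFS {k ℓ : ℕ} {p : Fin k → ℝ} (hp : Function.Injective p) {a b : ℝ}
    (hab : ∀ i, p i ∈ Set.Icc a b) {A : OnlineAlg ℝ k ℓ} (hA : A.IsIDAS a b p) : A.IsMPFS :=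
  ⟨fun ρ => idasOrder p hp a b ρ, fun h r hlen s hs =>
    (idasOrder_le_iff hp hab _ _).mpr (hA h r hlen s hs)⟩

/-- The free server of highest priority, when server `s` has been matched `m s` times. -/
noncomputable def bestFree {k : ℕ} (ℓ : ℕ) (hk : 0 < k) (o : LinearOrder (Fin k)) (m : Fin k → ℕ) : Fin k :=
  open Classical in
  -- The value `⟨0, hk⟩` occurs only if no server is free, where nothing is required of the
  -- algorithm.
  if h : ∃ t, m t < ℓ ∧ ∀ s, m s < ℓ → o.le s t then h.choose else ⟨0, hk⟩

theorem bestFree_spec {k ℓ : ℕ} (hk : 0 < k) (o : LinearOrder (Fin k)) {m : Fin k → ℕ}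
    (hm : ∃ s, m s < ℓ) :
    m (bestFree ℓ hk o m) < ℓ ∧ ∀ s, m s < ℓ → o.le s (bestFree ℓ hk o m) := by
  have h : ∃ t, m t < ℓ ∧ ∀ s, m s < ℓ → o.le s t := by
    obtain ⟨s, hs⟩ := hm
    obtain ⟨t, ht, hmax⟩ := @Finset.exists_max_image _ _ o
      (Finset.univ.filter fun s => m s < ℓ) id ⟨s, by simpa using hs⟩
    exact ⟨t, by simpa using ht, fun s hs => hmax s (by simpa using hs)⟩
  unfold bestFree
  rw [dif_pos h]
  exact h.choose_spec

/-- The loads of the servers when each request is matched with the best free server. -/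
noncomputable def bestFreeLoad {X : Type*} {k : ℕ} (ℓ : ℕ) (hk : 0 < k) (o : X → LinearOrder (Fin k)) :
    List X → Fin k → ℕ
  | [], _ => 0
  | r :: h, s => bestFreeLoad ℓ hk o h s +
      if bestFree ℓ hk (o r) (bestFreeLoad ℓ hk o h) = s then 1 else 0

/-- The rule depends on the loads and `load` depends on the rule; the separate recursion
`bestFreeLoad` breaks this circle. -/
theorem load_bestFree {X : Type*} {k : ℕ} (ℓ : ℕ) (hk : 0 < k) (o : X → LinearOrder (Fin k))
    (h : List X) :
    load (fun h r => bestFree ℓ hk (o r) (bestFreeLoad ℓ hk o h)) h = bestFreeLoad ℓ hk o h := by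
  induction h with
  | nil => rfl
  | cons r h ih => funext s; rw [load, bestFreeLoad, ih]

theorem exists_onlineAlg_of_priority {X : Type*} {k : ℕ} (ℓ : ℕ) (hk : 0 < k)
    (o : X → LinearOrder (Fin k)) :
    ∃ A : OnlineAlg X k ℓ, ∀ (h : List X) (r : X), h.length < k * ℓ →
      ∀ s : Fin k, A.IsFree h s → (o r).le s (A.serve h r) := by
  have hfree : ∀ h : List X, h.length < k * ℓ → ∃ s, bestFreeLoad ℓ hk o h s < ℓ := by
    intro h hlen
    by_contra hcon
    push Not at hcon
    have h1 := Finset.sum_le_sum (s := Finset.univ) (fun s _ => hcon s)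
    rw [← load_bestFree, sum_load] at h1
    simp at h1
    omega
  refine ⟨⟨fun h r => bestFree ℓ hk (o r) (bestFreeLoad ℓ hk o h), fun h r hlen => ?_⟩,
    fun h r hlen s hs => ?_⟩
  · rw [load_bestFree]
    exact (bestFree_spec hk (o r) (hfree h hlen)).1
  · refine (bestFree_spec hk (o r) (hfree h hlen)).2 s ?_
    unfold OnlineAlg.IsFree at hs
    rwa [load_bestFree] at hs

theorem exists_isIDAS {k : ℕ} (ℓ : ℕ) (hk : 0 < k) {p : Fin k → ℝ} (hp : Function.Injective p)
    {a b : ℝ} (hab : ∀ i, p i ∈ Set.Icc a b) : ∃ A : OnlineAlg ℝ k ℓ, A.IsIDAS a b p := by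
  obtain ⟨A, hA⟩ := exists_onlineAlg_of_priority ℓ hk (fun ρ => idasOrder p hp a b ρ)
  exact ⟨A, fun h r hlen s hs => (idasOrder_le_iff hp hab _ _).mp (hA h r hlen s hs)⟩

/-! ### A partition of the servers for the adversary -/

/-- Step to an element of `P` that has higher priority than all elements outside of `P`. -/
def DominantStep {V : Type*} (pr : V → LinearOrder V) (P : Finset V) (v w : V) : Prop :=
  w ∈ P ∧ ∀ z, z ∉ P → (pr v).lt z w

/-- Every element of `P` is joined to `a ∈ P` by dominant steps. -/
def IsAnchored {V : Type*} (pr : V → LinearOrder V) (P : Finset V) (a : V) : Prop :=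
  a ∈ P ∧ ∀ x ∈ P, Relation.ReflTransGen (DominantStep pr P) x a

/-- Enlarging `P` leaves fewer outside elements to beat, so dominant steps stay dominant. -/
theorem IsAnchored.reflTransGen_mono {V : Type*} {pr : V → LinearOrder V} {P Q : Finset V} {a x : V}
    (h : IsAnchored pr P a) (hPQ : P ⊆ Q) (hx : x ∈ P) :
    Relation.ReflTransGen (DominantStep pr Q) x a :=
  Relation.ReflTransGen.mono
    (fun _ _ hvw => ⟨hPQ hvw.1, fun z hz => hvw.2 z fun hzP => hz (hPQ hzP)⟩) _ _ (h.2 x hx)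

theorem exists_best_notMem {V : Type*} [Fintype V] [DecidableEq V] (o : LinearOrder V)
    {M : Finset V} {b : V} (hb : b ∉ M) : ∃ w, w ∉ M ∧ ∀ z, z ∉ M → z ≠ w → o.lt z w := by
  obtain ⟨w, hw, hmax⟩ := @Finset.exists_max_image _ _ o Mᶜ id ⟨b, by simpa using hb⟩
  refine ⟨w, by simpa using hw, fun z hz hne => ?_⟩
  exact @lt_of_le_of_ne _ o.toPartialOrder _ _ (hmax z (by simpa using hz)) hne

/-- Take `P` of maximal size anchored at `a` and avoiding `b`. For `u ≠ b` outside `P`, take `M ∋ u`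
of maximal size, anchored at some `v` and avoiding `P` and `b`. Let `w` be the favourite of `v`
outside `M`. If `w ∈ P`, then `P ∪ M` contradicts the choice of `P`; if `w ∉ P` and `w ≠ b`, then
`insert w M`, anchored at `w`, contradicts the choice of `M`. So `w = b`, and `u` reaches `b`
through `v`. -/
theorem exists_anchored_partition {V : Type*} [Fintype V] [DecidableEq V]
    (pr : V → LinearOrder V) {a b : V} (hab : a ≠ b) :
    ∃ P : Finset V, IsAnchored pr P a ∧ IsAnchored pr Pᶜ b := by
  classical
  obtain ⟨P, hP, hPmax⟩ := Finset.exists_max_image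
    (Finset.univ.filter fun P : Finset V => IsAnchored pr P a ∧ b ∉ P) Finset.card
    ⟨{a}, by
      simp only [Finset.mem_filter, Finset.mem_univ, true_and, Finset.mem_singleton]
      refine ⟨⟨by simp, fun x hx => ?_⟩, hab.symm⟩
      rw [Finset.mem_singleton.mp hx]⟩
  simp only [Finset.mem_filter, Finset.mem_univ, true_and] at hP hPmax
  obtain ⟨hPa, hbP⟩ := hP
  refine ⟨P, hPa, by simpa using hbP, fun u hu => ?_⟩
  by_cases hub : u = b
  · rw [hub]
  obtain ⟨M, hM, hMmax⟩ := Finset.exists_max_image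
    (Finset.univ.filter fun M : Finset V =>
      u ∈ M ∧ Disjoint M P ∧ b ∉ M ∧ ∃ v, IsAnchored pr M v) Finset.card
    ⟨{u}, by
      simp only [Finset.mem_filter, Finset.mem_univ, true_and, Finset.mem_singleton]
      refine ⟨by simpa using hu, fun h => hub h.symm, u, by simp, fun x hx => ?_⟩
      rw [Finset.mem_singleton.mp hx]⟩
  simp only [Finset.mem_filter, Finset.mem_univ, true_and] at hM hMmax
  obtain ⟨huM, hMP, hbM, v, hv⟩ := hM
  obtain ⟨w, hwM, hw⟩ := exists_best_notMem (pr v) hbM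
  have hMPc : M ⊆ Pᶜ := fun z hz => by
    simpa using Finset.disjoint_left.mp hMP hz
  by_cases hwP : w ∈ P
  · exfalso
    have hanch : IsAnchored pr (P ∪ M) a := by
      refine ⟨Finset.mem_union_left _ hPa.1, fun x hx => ?_⟩
      rcases Finset.mem_union.mp hx with h | h
      · exact hPa.reflTransGen_mono Finset.subset_union_left h
      · refine (hv.reflTransGen_mono Finset.subset_union_right h).trans
          (Relation.ReflTransGen.head ?_ (hPa.reflTransGen_mono Finset.subset_union_left hwP))
        refine ⟨Finset.mem_union_left _ hwP, fun z hz => hw z ?_ ?_⟩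
        · exact fun h => hz (Finset.mem_union_right _ h)
        · rintro rfl; exact hz (Finset.mem_union_left _ hwP)
    have := hPmax (P ∪ M) ⟨hanch, by simp [hbP, hbM]⟩
    rw [Finset.card_union_of_disjoint hMP.symm] at this
    have : 0 < M.card := Finset.card_pos.mpr ⟨u, huM⟩
    omega
  by_cases hwb : w = b
  · subst hwb
    refine (hv.reflTransGen_mono hMPc huM).tail ⟨by simpa using hbP, fun z hz => hw z ?_ ?_⟩
    · exact fun h => hz (hMPc h)
    · rintro rfl; exact hz (by simpa using hwP)
  · exfalso
    have hanch : IsAnchored pr (insert w M) w := by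
      refine ⟨Finset.mem_insert_self _ _, fun x hx => ?_⟩
      rcases Finset.mem_insert.mp hx with rfl | h
      · exact Relation.ReflTransGen.refl
      · refine (hv.reflTransGen_mono (Finset.subset_insert _ _) h).tail
          ⟨Finset.mem_insert_self _ _, fun z hz => hw z ?_ ?_⟩
        · exact fun h => hz (Finset.mem_insert_of_mem h)
        · rintro rfl; exact hz (Finset.mem_insert_self _ _)
    have := hMmax (insert w M) ⟨Finset.mem_insert_of_mem huM,
      Finset.disjoint_insert_left.mpr ⟨hwP, hMP⟩, by
        simp only [Finset.mem_insert, not_or]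
        exact ⟨fun h => hwb h.symm, hbM⟩, w, hanch⟩
    rw [Finset.card_insert_of_notMem hwM] at this
    omega

/-! ### Paths of most preferred servers -/

/-- The first element of the list has the highest priority. -/
def IsHeadBest {V : Type*} (o : LinearOrder V) : List V → Prop
  | [] => True
  | w :: L => ∀ z ∈ L, o.le z w

/-- Every element of the list is, among the later ones, followed by the one it prefers most. -/
def IsPreferencePath {V : Type*} (pr : V → LinearOrder V) : List V → Prop
  | [] => True
  | w :: L => w ∉ L ∧ IsHeadBest (pr w) L ∧ IsPreferencePath pr L

theorem IsPreferencePath.nodup {V : Type*} {pr : V → LinearOrder V} {L : List V}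
    (h : IsPreferencePath pr L) : L.Nodup := by
  induction L with
  | nil => exact List.nodup_nil
  | cons w L ih => exact List.nodup_cons.mpr ⟨h.1, ih h.2.2⟩

/-- Initial elements are dropped until the head is best for `o`. An element beating `y` survives
each deletion, since a head is dropped only if a later element beats it; so `a` is never dropped. -/
theorem IsPreferencePath.exists_isHeadBest {V : Type*} {pr : V → LinearOrder V} {a y : V}
    (o : LinearOrder V) (L : List V) (h : IsPreferencePath pr (L ++ [a, y]))
    (hz : ∃ z ∈ L ++ [a], o.lt y z) :
    ∃ L', IsHeadBest o (L' ++ [a, y]) ∧ IsPreferencePath pr (L' ++ [a, y]) := by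
  induction L with
  | nil =>
    obtain ⟨z, hz, hyz⟩ := hz
    simp only [List.nil_append, List.mem_singleton] at hz
    subst hz
    refine ⟨[], ?_, h⟩
    intro x hx
    rw [List.mem_singleton.mp hx]
    exact @le_of_lt _ o.toPreorder _ _ hyz
  | cons w L ih =>
    by_cases hbest : ∀ z ∈ L ++ [a, y], o.le z w
    · exact ⟨w :: L, hbest, h⟩
    · push Not at hbest
      obtain ⟨x, hx, hxw⟩ := hbest
      refine ih h.2.2 ?_
      obtain ⟨z, hz, hyz⟩ := hz
      rcases List.mem_cons.mp hz with rfl | hz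
      · have hyx : o.lt y x := @lt_trans _ o.toPreorder _ _ _ hyz hxw
        refine ⟨x, ?_, hyx⟩
        have hne : x ≠ y := by
          rintro rfl
          exact @lt_irrefl _ o.toPreorder _ hyx
        simp only [List.mem_append, List.mem_cons, List.not_mem_nil, or_false] at hx ⊢
        tauto
      · exact ⟨z, hz, hyz⟩

/-- A walk whose servers all beat `y` becomes greedy from its end backwards: prepend the new server
unless it already occurs, then shorten the front. -/
theorem exists_isPreferencePath {V : Type*} {pr : V → LinearOrder V} {a y v : V}
    (h : Relation.ReflTransGen (fun v w => (pr v).lt y w) v a) (o : LinearOrder V)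
    (ho : o.lt y v) :
    ∃ L, IsHeadBest o (L ++ [a, y]) ∧ IsPreferencePath pr (L ++ [a, y]) := by
  induction h using Relation.ReflTransGen.head_induction_on generalizing o with
  | refl =>
    have hne : a ≠ y := by
      rintro rfl
      exact @lt_irrefl _ o.toPreorder _ ho
    refine ⟨[], ?_, ?_, ?_, ?_, trivial, trivial⟩
    · intro x hx
      rw [List.mem_singleton.mp hx]
      exact @le_of_lt _ o.toPreorder _ _ ho
    · simpa using hne
    · intro x hx; simp at hx
    · simp
  | @head v w hvw _ ih =>
    have hne : v ≠ y := by
      rintro rfl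
      exact @lt_irrefl _ o.toPreorder _ ho
    obtain ⟨L, hL, hpath⟩ := ih (pr v) hvw
    by_cases hv : v ∈ L ++ [a, y]
    · refine hpath.exists_isHeadBest o L ⟨v, ?_, ho⟩
      simp only [List.mem_append, List.mem_cons, List.not_mem_nil, or_false] at hv ⊢
      tauto
    · exact IsPreferencePath.exists_isHeadBest o (v :: L) ⟨hv, hL, hpath⟩ ⟨v, by simp, ho⟩

/-- The length of the path that starts at `q` and visits the servers of a list. -/
def pathLength {X : Type*} [MetricSpace X] {k : ℕ} (p : Fin k → X) : X → List (Fin k) → ℝ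
  | _, [] => 0
  | q, w :: L => dist q (p w) + pathLength p (p w) L

theorem le_pathLength {X : Type*} [MetricSpace X] {k : ℕ} (p : Fin k → X) (a y : Fin k)
    (L : List (Fin k)) (q : X) :
    dist q (p a) + dist (p a) (p y) ≤ pathLength p q (L ++ [a, y]) := by
  induction L generalizing q with
  | nil => simp [pathLength]
  | cons w L ih =>
    have h1 := ih (p w)
    have h2 := dist_triangle q (p w) (p a)
    simp only [List.cons_append, pathLength]
    linarith

/-! ### The adversary. -/

/-- `A` follows the priority orders `pr`. -/
def OnlineAlg.Follows {X : Type*} {k ℓ : ℕ} (A : OnlineAlg X k ℓ) (pr : X → LinearOrder (Fin k)) :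
    Prop :=
  ∀ (h : List X) (r : X), h.length < k * ℓ → ∀ s : Fin k, A.IsFree h s →
    (pr r).le s (A.serve h r)

theorem length_lt_of_load {X : Type*} {k ℓ : ℕ} {serve : List X → X → Fin k} {h : List X}
    {s : Fin k} (hle : ∀ z, load serve h z ≤ ℓ) (hs : load serve h s < ℓ) : h.length < k * ℓ := by
  rw [← sum_load serve h]
  calc ∑ z, load serve h z < ∑ _z : Fin k, ℓ :=
        Finset.sum_lt_sum (fun z _ => hle z) ⟨s, Finset.mem_univ s, hs⟩
    _ = k * ℓ := by simp

/-- The free servers are exactly those of the list, each with one place left. -/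
theorem OnlineAlg.Follows.serve_eq {X : Type*} {k ℓ : ℕ} {A : OnlineAlg X k ℓ}
    {pr : X → LinearOrder (Fin k)} (hA : A.Follows pr) {h : List X} {q : X} {w : Fin k}
    {L : List (Fin k)} (hbest : IsHeadBest (pr q) (w :: L))
    (hload : ∀ s, load A.serve h s + (if s ∈ w :: L then 1 else 0) = ℓ) :
    h.length < k * ℓ ∧ A.serve h q = w := by
  have hle : ∀ z, load A.serve h z ≤ ℓ := fun z => by have := hload z; omega
  have hw : load A.serve h w < ℓ := by
    have := hload w
    rw [if_pos (by simp)] at this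
    omega
  have hlen := length_lt_of_load hle hw
  refine ⟨hlen, ?_⟩
  have hmem : A.serve h q ∈ w :: L := by
    by_contra hcon
    have h1 := hload (A.serve h q)
    rw [if_neg hcon] at h1
    have h2 := A.feasible h q hlen
    omega
  refine @le_antisymm _ (pr q).toPartialOrder _ _ ?_ (hA h q hlen w hw)
  rcases List.mem_cons.mp hmem with h1 | h1
  · rw [h1]
    exact @le_refl _ (pr q).toPreorder _
  · exact hbest _ h1

/-- Each new request is placed at the server just taken. Here `t` is the offline server of the
current request `q`; from the second request on, it is the server at `q` itself, so only the first
one costs anything offline. -/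
theorem OnlineAlg.Follows.exists_run {X : Type*} [MetricSpace X] {k ℓ : ℕ} {A : OnlineAlg X k ℓ}
    {pr : X → LinearOrder (Fin k)} (hA : A.Follows pr) (p : Fin k → X) (y : Fin k)
    (L : List (Fin k)) (q : X) (t : Fin k) (h : List X) (m : Fin k → ℕ) (C : ℝ)
    (hbest : IsHeadBest (pr q) (L ++ [y]))
    (hpath : IsPreferencePath (fun v => pr (p v)) (L ++ [y]))
    (hload : ∀ s, load A.serve h s + (if s ∈ L ++ [y] then 1 else 0) = ℓ)
    (hoff : IsOfflineCost p h m C)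
    (hm : ∀ s, m s + (if t = s then 1 else 0) + (if s ∈ L then 1 else 0) ≤ ℓ) :
    ∃ τ : List X, τ.length ≤ k * ℓ ∧ A.cost p τ = A.cost p h + pathLength p q (L ++ [y]) ∧
      opt p ℓ τ ≤ C + dist q (p t) := by
  induction L generalizing q t h m C with
  | nil =>
    obtain ⟨hlen, hserve⟩ := hA.serve_eq hbest hload
    refine ⟨q :: h, by simpa using hlen, ?_, (hoff.cons q t).opt_le (by simpa using hm)⟩
    simp [OnlineAlg.cost, hserve, pathLength]
  | cons w L ih =>
    obtain ⟨hlen, hserve⟩ := hA.serve_eq hbest hload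
    have hwL : w ∉ L ++ [y] := hpath.1
    obtain ⟨τ, hτ, hcost, hopt⟩ := ih (p w) w (q :: h) _ _ hpath.2.1 hpath.2.2
      (by
        intro s
        refine Eq.trans ?_ (hload s)
        rw [load, hserve]
        by_cases hs : w = s
        · subst hs; simp at hwL; simp [hwL]
        · simp [hs, Ne.symm hs])
      (hoff.cons q t)
      (by
        intro s
        refine le_trans ?_ (hm s)
        by_cases hs : w = s
        · subst hs; simp at hwL; simp [hwL]
        · simp [hs, Ne.symm hs])
    refine ⟨τ, hτ, ?_, by simpa using hopt⟩
    rw [hcost, OnlineAlg.cost, hserve]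
    simp only [List.cons_append, pathLength]
    ring

theorem OnlineAlg.Follows.load_map {X : Type*} [MetricSpace X] {k ℓ : ℕ} {A : OnlineAlg X k ℓ}
    {pr : X → LinearOrder (Fin k)} (hA : A.Follows pr) (p : Fin k → X)
    (htop : ∀ s s', (pr (p s)).le s' s) (T : List (Fin k)) (hT : ∀ s, T.count s ≤ ℓ) :
    (∀ s, load A.serve (T.map p) s = T.count s) ∧ A.cost p (T.map p) = 0 ∧
      IsOfflineCost p (T.map p) (fun s => T.count s) 0 := by
  induction T with
  | nil => exact ⟨by simp [load], rfl, by simpa using isOfflineCost_nil p⟩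
  | cons t T ih =>
    have hcount : ∀ s, (t :: T).count s = T.count s + if t = s then 1 else 0 := fun s => by
      rw [List.count_cons]; simp
    obtain ⟨h1, h2, h3⟩ := ih fun s => by have := hT s; rw [hcount] at this; omega
    have ht : load A.serve (T.map p) t < ℓ := by
      have := hT t
      rw [hcount, if_pos rfl] at this
      rw [h1]
      omega
    have hlen := length_lt_of_load (fun z => by
      have := hT z; rw [hcount] at this; rw [h1]; omega) ht
    have hserve : A.serve (T.map p) (p t) = t :=
      @le_antisymm _ (pr (p t)).toPartialOrder _ _ (htop _ _) (hA _ _ hlen _ ht)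
    refine ⟨fun s => ?_, ?_, ?_⟩
    · rw [List.map_cons, load, hserve, h1, hcount]
    · rw [List.map_cons, OnlineAlg.cost, hserve, h2]; simp
    · have := h3.cons (p t) t
      rw [dist_self, add_zero] at this
      simpa [hcount] using this

theorem exists_list_count_eq {k : ℕ} (m : Fin k → ℕ) :
    ∃ T : List (Fin k), ∀ s, T.count s = m s := by
  refine ⟨(∑ s, Multiset.replicate (m s) s).toList, fun s => ?_⟩
  rw [← Multiset.coe_count, Multiset.coe_toList, Multiset.count_sum']
  simp [Multiset.count_replicate]

/-- The adversary against an algorithm that follows priority orders. -/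
theorem OnlineAlg.IsCompetitive.dist_add_dist_le {X : Type*} [MetricSpace X] {k ℓ : ℕ} (hℓ : 1 ≤ ℓ)
    {A : OnlineAlg X k ℓ} {pr : X → LinearOrder (Fin k)} (hA : A.Follows pr) {p : Fin k → X}
    (htop : ∀ s s', (pr (p s)).le s' s) {c : ℝ} (hc : 0 ≤ c) (hcomp : A.IsCompetitive p c)
    {a y v : Fin k} (hv : Relation.ReflTransGen (fun v w => (pr (p v)).lt y w) v a)
    {r : X} (hr : (pr r).lt y v) :
    dist r (p a) + dist (p a) (p y) ≤ c * dist r (p y) := by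
  obtain ⟨L, hbest, hpath⟩ := exists_isPreferencePath (pr := fun v => pr (p v)) hv (pr r) hr
  -- Requests at the servers themselves fill, at no cost, every place except one at each server of
  -- the path.
  obtain ⟨T, hT⟩ := exists_list_count_eq (fun s => ℓ - if s ∈ L ++ [a, y] then 1 else 0)
  obtain ⟨h1, h2, h3⟩ := hA.load_map p htop T (fun s => by rw [hT]; omega)
  have hL : L ++ [a, y] = (L ++ [a]) ++ [y] := by simp
  have hnodup := hpath.nodup
  have hle := le_pathLength p a y L r
  simp only [hL] at *
  have hy : y ∉ L ++ [a] := fun hy =>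
    (List.nodup_append.mp hnodup).2.2 y hy y (by simp) rfl
  obtain ⟨τ, hτ, hcost, hopt⟩ := hA.exists_run p y (L ++ [a]) r y (T.map p) _ 0 hbest hpath
    (by intro s; rw [h1, hT]; split_ifs <;> omega) h3
    (by
      intro s
      simp only [hT]
      by_cases hs : y = s
      · subst hs; rw [if_neg hy, if_pos rfl, if_pos (by simp)]; omega
      · rw [if_neg hs]
        have : s ∈ L ++ [a] ++ [y] ↔ s ∈ L ++ [a] := by simp [Ne.symm hs]
        simp only [this]
        split_ifs <;> omega)
  rw [h2, zero_add] at hcost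
  calc dist r (p a) + dist (p a) (p y) ≤ A.cost p τ := by rw [hcost]; exact hle
    _ ≤ c * opt p ℓ τ := hcomp τ hτ
    _ ≤ c * dist r (p y) := mul_le_mul_of_nonneg_left (by simpa using hopt) hc

/-- A single request at `p s` has optimum 0, so a competitive algorithm must serve it with `s` while
all servers are free. -/
theorem OnlineAlg.IsCompetitive.priority_self {X : Type*} [MetricSpace X] {k ℓ : ℕ} (hℓ : 1 ≤ ℓ)
    {A : OnlineAlg X k ℓ} {pr : X → LinearOrder (Fin k)} (hA : A.Follows pr) {p : Fin k → X}
    (hp : Function.Injective p) {c : ℝ} (hc : 0 ≤ c) (hcomp : A.IsCompetitive p c)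
    (s s' : Fin k) : (pr (p s)).le s' s := by
  have hlen : ([] : List X).length < k * ℓ := Nat.mul_pos s.pos hℓ
  have hopt : opt p ℓ [p s] ≤ 0 := by
    have := (isOfflineCost_nil p).cons (p s) s
    rw [dist_self, add_zero] at this
    refine this.opt_le fun z => ?_
    split_ifs <;> omega
  have h1 := hcomp [p s] (Nat.mul_pos s.pos hℓ)
  have h2 : dist (p s) (p (A.serve [] (p s))) ≤ 0 := by
    simp only [OnlineAlg.cost, zero_add] at h1
    exact h1.trans (mul_nonpos_of_nonneg_of_nonpos hc hopt)
  have h3 : A.serve [] (p s) = s := (hp (dist_le_zero.mp h2)).symm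
  have h4 := hA [] (p s) hlen s' hℓ
  rwa [h3] at h4

/-- No algorithm that follows priority orders is better than `(2 * k - 1)`-competitive. -/
theorem OnlineAlg.IsCompetitive.le_of_isMPFS {k ℓ : ℕ} (hℓ : 1 ≤ ℓ) {p : Fin k → ℝ} {d : ℝ}
    (hp : Equispaced p d) {A : OnlineAlg ℝ k ℓ} (hA : A.IsMPFS) {c : ℝ} (hc : 1 ≤ c)
    (hcomp : A.IsCompetitive p c) : 2 * (k : ℝ) - 1 ≤ c := by
  obtain ⟨pr, hpr⟩ := hA
  have hF : A.Follows pr := hpr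
  have hc0 : 0 ≤ c := by linarith
  have htop := hcomp.priority_self hℓ hF hp.injective hc0
  rcases Nat.lt_or_ge 1 k with hk | hk
  swap
  · have : (k : ℝ) ≤ 1 := by exact_mod_cast hk
    linarith
  obtain ⟨n, rfl⟩ : ∃ n, k = n + 1 := ⟨k - 1, by omega⟩
  have hd := hp.1
  have hpos := hp.eq_add_mul (s₁ := 0) rfl
  generalize p 0 = o at hpos
  have hne : (0 : Fin (n + 1)) ≠ Fin.last n := by
    intro h
    have := congrArg Fin.val h
    simp at this
    omega
  obtain ⟨P, hP, hQ⟩ := exists_anchored_partition (fun v => pr (p v)) hne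
  -- Dominant steps within `P` beat `i.succ`, and those within the complement beat `i.castSucc`, so
  -- the adversary can use either neighbour as the final server `y`.
  obtain ⟨i, hi, hi'⟩ : ∃ i : Fin n, i.castSucc ∈ P ∧ i.succ ∉ P := by
    by_contra hcon
    push Not at hcon
    have hall : ∀ j : Fin (n + 1), j ∈ P := fun j => by
      induction j using Fin.induction with
      | zero => exact hP.1
      | succ j ih => exact hcon j ih
    exact Finset.mem_compl.mp hQ.1 (hall _)
  have hleft : ∀ r, (pr r).lt i.succ i.castSucc →
      dist r (p 0) + dist (p 0) (p i.succ) ≤ c * dist r (p i.succ) := fun r hr =>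
    hcomp.dist_add_dist_le hℓ hF htop hc0
      (Relation.ReflTransGen.mono (fun v w hvw => hvw.2 _ hi') _ _ (hP.2 _ hi)) hr
  have hright : ∀ r, (pr r).lt i.castSucc i.succ →
      dist r (p (Fin.last n)) + dist (p (Fin.last n)) (p i.castSucc) ≤
        c * dist r (p i.castSucc) := fun r hr =>
    hcomp.dist_add_dist_le hℓ hF htop hc0
      (Relation.ReflTransGen.mono (fun v w hvw => hvw.2 _ (by simpa using hi)) _ _
        (hQ.2 _ (by simpa using hi'))) hr
  by_contra hcon
  push Not at hcon
  have hin : ((i : ℕ) : ℝ) + 1 ≤ n := by exact_mod_cast i.isLt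
  have hi0 : (0 : ℝ) ≤ (i : ℕ) := by positivity
  push_cast at hcon
  have hc1 : 0 < c + 1 := by linarith
  -- In units of `d`, `hleft` fails at `ρ ∈ (i, i + 1)` above the first quotient and `hright` fails
  -- below the second. The first quotient is less than the second exactly when `c < 2 * n + 1`.
  have hlt : max ((c - 1) * ((i : ℕ) + 1) / (c + 1)) ((i : ℕ) : ℝ) <
      min ((2 * n - (i : ℕ) + c * (i : ℕ)) / (c + 1)) ((i : ℕ) + 1 : ℝ) := by
    rw [max_lt_iff, lt_min_iff, lt_min_iff]
    refine ⟨⟨?_, ?_⟩, ?_, by linarith⟩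
    · rw [div_lt_div_iff_of_pos_right hc1]; nlinarith
    · rw [div_lt_iff₀ hc1]; nlinarith
    · rw [lt_div_iff₀ hc1]; nlinarith
  obtain ⟨ρ, hρ1, hρ2⟩ := exists_between hlt
  rw [max_lt_iff, div_lt_iff₀ hc1] at hρ1
  rw [lt_min_iff, lt_div_iff₀ hc1] at hρ2
  have hdist : ∀ x y : ℝ, dist (o + d * x) (o + d * y) = d * |x - y| := by
    intro x y
    rw [Real.dist_eq, ← abs_of_pos hd, ← abs_mul, abs_of_pos hd]
    congr 1
    ring
  have hne' : i.castSucc ≠ i.succ := (Fin.castSucc_lt_succ).ne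
  rcases @lt_or_gt_of_ne _ (pr (o + d * ρ)) _ _ hne' with h | h
  · have h1 := hright _ h
    rw [hpos (Fin.last n), hpos i.castSucc, hdist, hdist, hdist] at h1
    simp only [Fin.val_last, Fin.val_castSucc] at h1
    rw [abs_of_nonpos (by linarith), abs_of_nonneg (by linarith),
      abs_of_nonneg (by linarith)] at h1
    have h2 : d * (n - ρ + (n - (i : ℕ))) ≤ d * (c * (ρ - (i : ℕ))) := by linarith
    have h3 := le_of_mul_le_mul_left h2 hd
    linarith
  · have h1 := hleft _ h
    rw [hpos 0, hpos i.succ, hdist, hdist, hdist] at h1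
    simp only [Fin.val_zero, Fin.val_succ] at h1
    push_cast at h1
    rw [abs_of_nonneg (by linarith), abs_of_nonpos (by linarith),
      abs_of_nonpos (by linarith)] at h1
    have h2 : d * (ρ + ((i : ℕ) + 1)) ≤ d * (c * ((i : ℕ) + 1 - ρ)) := by linarith
    have h3 := le_of_mul_le_mul_left h2 hd
    linarith

end OnlineFacility

theorem mainTheorem8 (k ℓ : ℕ) (hk : 1 ≤ k) (hℓ : 1 ≤ ℓ) (p : Fin k → ℝ) (d : ℝ)
    (hp : OnlineFacility.Equispaced p d) (s₁ sₖ : Fin k)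
    (h_first : (s₁ : ℕ) = 0) (h_last : (sₖ : ℕ) = k - 1) :
    (∃ A : OnlineFacility.OnlineAlg ℝ k ℓ, A.IsIDAS (p s₁) (p sₖ) p) ∧
    ∀ A : OnlineFacility.OnlineAlg ℝ k ℓ, A.IsIDAS (p s₁) (p sₖ) p →
      A.IsMPFS ∧
      A.competitiveRatio p ≤ ((2 * (k : ℝ) - 1 : ℝ) : EReal) ∧
      ∀ A' : OnlineFacility.OnlineAlg ℝ k ℓ, A'.IsMPFS →
        ((2 * (k : ℝ) - 1 : ℝ) : EReal) ≤ A'.competitiveRatio p ∧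
        A.competitiveRatio p ≤ A'.competitiveRatio p := by
  have hab : ∀ i, p i ∈ Set.Icc (p s₁) (p sₖ) := fun i => by
    constructor
    · by_contra hcon
      push Not at hcon
      have := hp.lt_iff.mp hcon
      omega
    · by_contra hcon
      push Not at hcon
      have := hp.lt_iff.mp hcon
      have := i.isLt
      omega
  refine ⟨OnlineFacility.exists_isIDAS ℓ hk hp.injective hab, fun A hA => ?_⟩
  have hle : A.competitiveRatio p ≤ ((2 * (k : ℝ) - 1 : ℝ) : EReal) := by
    have hk' : (1 : ℝ) ≤ k := by exact_mod_cast hk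
    exact sInf_le ⟨_, ⟨by linarith, hA.isCompetitive hp h_first h_last⟩, rfl⟩
  refine ⟨hA.isMPFS hp.injective hab, hle, fun A' hA' => ?_⟩
  have hge : ((2 * (k : ℝ) - 1 : ℝ) : EReal) ≤ A'.competitiveRatio p := by
    refine le_sInf ?_
    rintro _ ⟨c, ⟨hc, hcomp⟩, rfl⟩
    exact EReal.coe_le_coe_iff.mpr (hcomp.le_of_isMPFS hℓ hp hA' hc)
  exact ⟨hge, hle.trans hge⟩
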